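/- All alphabets are finite and non-empty. Let $p_S$ be a distribution on $\mathcal S$, let $\{S(t)\}_{t\ge 1}$ be i.i.d. with law $p_S$, let $p_{Y_1,Y_2|X}$ be a discrete memoryless broadcast channel with input alphabet $\mathcal X$ and output alphabets $\mathcal Y_1,\mathcal Y_2$, and let $w_i:\mathcal S\times\hat{\mathcal S}_i\to[0,\infty)$, $i=1,2$, be distortion measures. For $\kappa\in\mathbb R$, a pair $(d_1,d_2)\in\mathbb R^2$ is *achievable subject to bandwidth expansion constraint $\kappa$* if for every $\epsilon>0$ there are integers $m\ge 1$, $n\ge 0$ with $n/m\le\kappa+\epsilon$, an encoder $f:\mathcal S^m\to\mathcal X^{n}$ and decoders $g_i:\mathcal Y_i^{n}\to\hat{\mathcal S}_i^m$, $i=1,2$, such that, when $X^n=f(S^m)$ is sent over $n$ uses of the channel and $\hat S_i^m=g_i(Y_i^n)$, one has $\frac1m\sum_{t=1}^m\mathbb E[w_i(S(t),\hat S_i(t))]\le d_i+\epsilon$ for $i=1,2$. Suppose $(d_1,d_2)$ is achievable subject to bandwidth expansion constraint $\kappa$. Then there exist a conditional distribution (virtual broadcast channel) $p_{\hat S_1,\hat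 S_2|S}$ with $\mathbb E[w_i(S,\hat S_i)]\le d_i$, $i=1,2$ (expectation under $p_Sp_{\hat S_1,\hat S_2|S}$), and a distribution $p_X$ on $\mathcal X$ such that the following condition holds. $(\ast)$ For every $p_{U_0,U_1,U_2|S}$ with finite alphabets $\mathcal U_0,\mathcal U_1,\mathcal U_2$ there exists $p_{V_0,V_1,V_2|X}$ with finite alphabets $\mathcal V_0,\mathcal V_1,\mathcal V_2$ such that, under $p_{U_0,U_1,U_2|S}\,p_S\,p_{\hat S_1,\hat S_2|S}$ and $p_{V_0,V_1,V_2|X}\,p_X\,p_{Y_1,Y_2|X}$, \begin{align*} &I(U_0;\hat S_i)\le\kappa I(V_0;Y_i),\quad i=1,2,\\ &I(U_0,U_i;\hat S_i)\le\kappa I(V_0,V_i;Y_i),\quad i=1,2,\\ &I(U_0;\hat S_1)+I(U_2;\hat S_2|U_0)\le\kappa[I(V_0;Y_1)+I(V_2;Y_2|V_0)],\\ &I(U_0;\hat S_2)+I(U_1;\hat S_1|U_0)\le\kappa[I(V_0;Y_2)+I(V_1;Y_1|V_0)],\\ &I(U_0,U_1;\hat S_1)+I(S;\hat S_2|U_0,U_1)\le\kappa[I(V_0,V_1;Y_1)+I(X;Y_2|V_0,V_1)],\\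 &I(U_0,U_2;\hat S_2)+I(S;\hat S_1|U_0,U_2)\le\kappa[I(V_0,V_2;Y_2)+I(X;Y_1|V_0,V_2)],\\ &I(U_0;\hat S_1)+I(U_2;\hat S_2|U_0)+I(S;\hat S_1|U_0,U_2)\le\kappa[I(V_0;Y_1)+I(V_2;Y_2|V_0)+I(X;Y_1|V_0,V_2)],\\ &I(U_0;\hat S_2)+I(U_1;\hat S_1|U_0)+I(S;\hat S_2|U_0,U_1)\le\kappa[I(V_0;Y_2)+I(V_1;Y_1|V_0)+I(X;Y_2|V_0,V_1)]. \end{align*} Moreover, for the above pair $p_{\hat S_1,\hat S_2|S}$, $p_X$ the alphabets in $(\ast)$ can, for every $p_{U_0,U_1,U_2|S}$, be taken with $|\mathcal V_0|\le|\mathcal X|+5$ and $|\mathcal V_i|\le|\mathcal X|$, $i=1,2$. Furthermore, it suffices to consider bounded alphabets: for every $p_{\hat S_1,\hat S_2|S}$ and every $p_X$, condition $(\ast)$ is equivalent to the condition obtained from it by restricting to $|\mathcal U_i|\le|\mathcal S|$, $i=0,1,2$, and requiring $|\mathcal V_0|\le|\mathcal X|+5$ and $|\mathcal V_i|\le|\mathcal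 X|$, $i=1,2$. -/

import Mathlib

open scoped NNReal

namespace SourceBroadcast

noncomputable section

/-- Probability mass functions on the finite alphabet `A`. -/
abbrev Distr (A : Type*) [Fintype A] : Type _ := stdSimplex ℝ A

/-- Conditional distributions `p_{B|A}`: a mass function on `B` for every `a : A`. -/
abbrev Channel (A B : Type*) [Fintype B] : Type _ := A → Distr B

section Information

variable {Ω A B C : Type*} [Fintype Ω] [Fintype A] [Fintype B] [Fintype C]

/-- The Shannon entropy `H(X)` (in nats) of the random variable `X` on the finite probability
space `(Ω, p)`; `stdSimplex.map X p` is the distribution of `X`. -/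
def entropy (p : Distr Ω) (X : Ω → A) : ℝ :=
  ∑ a, Real.negMulLog (stdSimplex.map X p a)

/-- The mutual information `I(X;Y) = H(X) + H(Y) - H(X,Y)`. -/
def mutualInfo (p : Distr Ω) (X : Ω → A) (Y : Ω → B) : ℝ :=
  entropy p X + entropy p Y - entropy p (fun ω => (X ω, Y ω))

/-- The conditional mutual information
`I(X;Y|Z) = H(X,Z) + H(Y,Z) - H(X,Y,Z) - H(Z)`. -/
def condMutualInfo (p : Distr Ω) (X : Ω → A) (Y : Ω → B) (Z : Ω → C) : ℝ :=
  entropy p (fun ω => (X ω, Z ω)) + entropy p (fun ω => (Y ω, Z ω))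
    - entropy p (fun ω => (X ω, Y ω, Z ω)) - entropy p Z

end Information

section Coding

variable {S T₁ T₂ X Y₁ Y₂ : Type*}
  [Fintype S] [Fintype T₁] [Fintype T₂] [Fintype X] [Fintype Y₁] [Fintype Y₂]

/-- The probability that the i.i.d. source emits the block `s` and that the memoryless broadcast
channel `W`, fed with the codeword `f s`, then outputs the block `y` of output pairs. -/
def blockProb (pS : Distr S) (W : Channel X (Y₁ × Y₂)) {m n : ℕ}
    (f : (Fin m → S) → (Fin n → X)) (s : Fin m → S) (y : Fin n → Y₁ × Y₂) : ℝ :=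
  (∏ t, pS (s t)) * ∏ q, W (f s q) (y q)

/-- The average expected distortion `(1/m) ∑ₜ E[w(S(t), Ŝ(t))]`, where the block of
reconstructions `Ŝ` is the function `g` of the block of output pairs. -/
def blockDistortion {T : Type*} (pS : Distr S) (W : Channel X (Y₁ × Y₂)) {m n : ℕ}
    (f : (Fin m → S) → (Fin n → X)) (g : (Fin n → Y₁ × Y₂) → (Fin m → T))
    (w : S → T → ℝ≥0) : ℝ :=
  (1 / (m : ℝ)) * ∑ t : Fin m,
    ∑ s : Fin m → S, ∑ y : Fin n → Y₁ × Y₂, blockProb pS W f s y * (w (s t) (g y t) : ℝ)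

/-- The distortion pair `(d₁, d₂)` is achievable under the distortion measures `w₁`, `w₂` subject
to the bandwidth expansion constraint `κ`: for every `ε > 0` there are a source block length
`m ≥ 1`, a channel block length `n` with `n / m ≤ κ + ε`, an encoder `f` and decoders `g₁`, `g₂`
(decoder `i` sees only the `i`-th components of the outputs) with distortions at most
`dᵢ + ε`. -/
def Achievable (pS : Distr S) (W : Channel X (Y₁ × Y₂)) (w₁ : S → T₁ → ℝ≥0) (w₂ : S → T₂ → ℝ≥0)
    (κ d₁ d₂ : ℝ) : Prop :=
  ∀ ε : ℝ, 0 < ε → ∃ (m n : ℕ) (f : (Fin m → S) → (Fin n → X))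
    (g₁ : (Fin n → Y₁) → (Fin m → T₁)) (g₂ : (Fin n → Y₂) → (Fin m → T₂)),
    0 < m ∧ (n : ℝ) / (m : ℝ) ≤ κ + ε ∧
    blockDistortion pS W f (fun y => g₁ (fun q => (y q).1)) w₁ ≤ d₁ + ε ∧
    blockDistortion pS W f (fun y => g₂ (fun q => (y q).2)) w₂ ≤ d₂ + ε

/-- `E[w₁(S, Ŝ₁)]` under `p_S p_{Ŝ₁,Ŝ₂|S}`. -/
def distortion₁ (pS : Distr S) (Q : Channel S (T₁ × T₂)) (w₁ : S → T₁ → ℝ≥0) : ℝ :=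
  ∑ s, ∑ r : T₁ × T₂, pS s * Q s r * (w₁ s r.1 : ℝ)

/-- `E[w₂(S, Ŝ₂)]` under `p_S p_{Ŝ₁,Ŝ₂|S}`. -/
def distortion₂ (pS : Distr S) (Q : Channel S (T₁ × T₂)) (w₂ : S → T₂ → ℝ≥0) : ℝ :=
  ∑ s, ∑ r : T₁ × T₂, pS s * Q s r * (w₂ s r.2 : ℝ)

end Coding

section Test

variable {A B₁ B₂ C₀ C₁ C₂ : Type*}
  [Fintype A] [Fintype B₁] [Fintype B₂] [Fintype C₀] [Fintype C₁] [Fintype C₂]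

/-- The joint distribution `p_{C₀,C₁,C₂|A} p_A p_{B₁,B₂|A}` of `((C₀, C₁, C₂), A, (B₁, B₂))`. -/
def joint (θ : Channel A (C₀ × C₁ × C₂)) (p : Distr A) (K : Channel A (B₁ × B₂)) :
    Distr ((C₀ × C₁ × C₂) × A × (B₁ × B₂)) :=
  ⟨fun ω => θ ω.2.1 ω.1 * p ω.2.1 * K ω.2.1 ω.2.2, by
    refine ⟨fun ω => mul_nonneg (mul_nonneg ((θ ω.2.1).2.1 _) (p.2.1 _)) ((K ω.2.1).2.1 _), ?_⟩
    have hθ : ∀ a, ∑ c, θ a c = 1 := fun a => (θ a).2.2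
    have hK : ∀ a, ∑ b, K a b = 1 := fun a => (K a).2.2
    have hp : ∑ a, p a = 1 := p.2.2
    rw [Fintype.sum_prod_type_right, Fintype.sum_prod_type]
    simp only [← Finset.sum_mul, hθ, one_mul, ← Finset.mul_sum, hK, mul_one, hp]⟩

/-- The ten information quantities that the test distribution `θ = p_{C₀,C₁,C₂|A}` induces on the
broadcast channel `K = p_{B₁,B₂|A}` with input distribution `p = p_A`. On the source side
`(A, B₁, B₂, C₀, C₁, C₂)` is `(S, Ŝ₁, Ŝ₂, U₀, U₁, U₂)`, on the channel side it is
`(X, Y₁, Y₂, V₀, V₁, V₂)`. -/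
def measurements (θ : Channel A (C₀ × C₁ × C₂)) (p : Distr A) (K : Channel A (B₁ × B₂)) :
    Fin 10 → ℝ :=
  let μ := joint θ p K
  let c₀ : (C₀ × C₁ × C₂) × A × (B₁ × B₂) → C₀ := fun ω => ω.1.1
  let c₁ : (C₀ × C₁ × C₂) × A × (B₁ × B₂) → C₁ := fun ω => ω.1.2.1
  let c₂ : (C₀ × C₁ × C₂) × A × (B₁ × B₂) → C₂ := fun ω => ω.1.2.2
  let c₀₁ : (C₀ × C₁ × C₂) × A × (B₁ × B₂) → C₀ × C₁ := fun ω => (ω.1.1, ω.1.2.1)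
  let c₀₂ : (C₀ × C₁ × C₂) × A × (B₁ × B₂) → C₀ × C₂ := fun ω => (ω.1.1, ω.1.2.2)
  let a : (C₀ × C₁ × C₂) × A × (B₁ × B₂) → A := fun ω => ω.2.1
  let b₁ : (C₀ × C₁ × C₂) × A × (B₁ × B₂) → B₁ := fun ω => ω.2.2.1
  let b₂ : (C₀ × C₁ × C₂) × A × (B₁ × B₂) → B₂ := fun ω => ω.2.2.2
  ![mutualInfo μ c₀ b₁,
    mutualInfo μ c₀ b₂,
    mutualInfo μ c₀₁ b₁,
    mutualInfo μ c₀₂ b₂,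
    mutualInfo μ c₀ b₁ + condMutualInfo μ c₂ b₂ c₀,
    mutualInfo μ c₀ b₂ + condMutualInfo μ c₁ b₁ c₀,
    mutualInfo μ c₀₁ b₁ + condMutualInfo μ a b₂ c₀₁,
    mutualInfo μ c₀₂ b₂ + condMutualInfo μ a b₁ c₀₂,
    mutualInfo μ c₀ b₁ + condMutualInfo μ c₂ b₂ c₀ + condMutualInfo μ a b₁ c₀₂,
    mutualInfo μ c₀ b₂ + condMutualInfo μ c₁ b₁ c₀ + condMutualInfo μ a b₂ c₀₁]

end Test

end

end SourceBroadcast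

open SourceBroadcast

/-!
Fix a code. Averaging the conditional law of the reconstructions over a uniformly chosen source
letter gives the virtual channel, which has the distortions of the code. For a test channel
`p_{U₀,U₁,U₂|S}`, let every source letter generate its own test letter. Since the pairs of source
and test letters are independent, the information between the test block and the channel outputs is
at least `m` times its single-letter counterpart on the virtual channel. In the other direction, the
same block quantities are bounded by sums of single-letter quantities of the physical channel: the
test blocks become auxiliary variables of the letter at time `q`, joined by the first outputs before
`q` and the second outputs after `q`, and the Csiszár sum identity controls the differences of
conditional output entropies.

An input law together with the conditional output entropies of a triple of auxiliary variables forms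
an entropy vector. For a fixed input law the ten information quantities are affine in this vector.
The vectors over all finite alphabets generate a convex cone, so that sums over time stay in it, and
each of its points is attained within the cardinality bounds by a Carathéodory argument in
`|X| + 5` dimensions: of the `|X| + 6` coordinates, one need not be preserved, since the quantities
are nondecreasing in it. The virtual channels and bounded test channels form compact spaces, so the
constraints for codes with slack `ε` pass to the limit `ε → 0`.
-/

namespace SourceBroadcast

noncomputable section

open Real (negMulLog)

/-! ### The entropy functional on unnormalised mass functions -/

section HomEntropy

variable {B ι : Type*} [Fintype B]

/-- The positively homogeneous extension of the Shannon entropy to unnormalised mass functions: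
for `v = c • p` with `p` a mass function, this is `c` times the entropy of `p`. -/
def homEntropy (v : B → ℝ) : ℝ := ∑ b, negMulLog (v b) - negMulLog (∑ b, v b)

@[simp] lemma homEntropy_zero : homEntropy (0 : B → ℝ) = 0 := by simp [homEntropy]

lemma homEntropy_smul (c : ℝ) (v : B → ℝ) : homEntropy (c • v) = c * homEntropy v := by
  simp only [homEntropy, Pi.smul_apply, smul_eq_mul, ← Finset.mul_sum, Real.negMulLog_mul,
    Finset.sum_add_distrib, ← Finset.sum_mul]
  ring

lemma homEntropy_eq_sum_perspective {v : B → ℝ} (hv : 0 ≤ v) :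
    homEntropy v = ∑ b, (∑ b', v b') * negMulLog (v b / ∑ b', v b') := by
  rcases eq_or_ne (∑ b, v b) 0 with h | h
  · have hzero : v = 0 := funext fun b =>
      (Finset.sum_eq_zero_iff_of_nonneg fun b _ => hv b).1 h b (Finset.mem_univ b)
    simp [hzero]
  set c := ∑ b, v b with hc
  have hsmul : v = c • fun b => v b / c := by ext b; simp [mul_div_cancel₀ _ h]
  have hsum : ∑ b, v b / c = 1 := by rw [← Finset.sum_div, ← hc, div_self h]
  conv_lhs => rw [hsmul, homEntropy_smul, homEntropy, hsum]
  simp [Finset.mul_sum]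

lemma perspective_negMulLog_add_le {x y a b : ℝ} (hx : 0 ≤ x) (hxa : x ≤ a) (hy : 0 ≤ y)
    (hyb : y ≤ b) :
    a * negMulLog (x / a) + b * negMulLog (y / b) ≤ (a + b) * negMulLog ((x + y) / (a + b)) := by
  rcases (hx.trans hxa).eq_or_lt with rfl | ha
  · simp [le_antisymm hxa hx]
  rcases (hy.trans hyb).eq_or_lt with rfl | hb
  · simp [le_antisymm hyb hy]
  have hab : 0 < a + b := add_pos ha hb
  have hmean : a / (a + b) * (x / a) + b / (a + b) * (y / b) = (x + y) / (a + b) := by field_simp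
  have hjensen : a / (a + b) * negMulLog (x / a) + b / (a + b) * negMulLog (y / b) ≤
      negMulLog ((x + y) / (a + b)) := by
    rw [← hmean]
    exact Real.concaveOn_negMulLog.2 (div_nonneg hx ha.le) (div_nonneg hy hb.le) (by positivity)
      (by positivity) (by field_simp)
  calc a * negMulLog (x / a) + b * negMulLog (y / b)
      = (a + b) * (a / (a + b) * negMulLog (x / a) + b / (a + b) * negMulLog (y / b)) := by
        field_simp
    _ ≤ (a + b) * negMulLog ((x + y) / (a + b)) := mul_le_mul_of_nonneg_left hjensen hab.le

lemma homEntropy_add_le {v w : B → ℝ} (hv : 0 ≤ v) (hw : 0 ≤ w) :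
    homEntropy v + homEntropy w ≤ homEntropy (v + w) := by
  have hle : ∀ {u : B → ℝ}, 0 ≤ u → ∀ b, u b ≤ ∑ b', u b' := fun hu b =>
    Finset.single_le_sum (fun i _ => hu i) (Finset.mem_univ b)
  simp only [homEntropy_eq_sum_perspective, hv, hw, add_nonneg, ← Finset.sum_add_distrib,
    Pi.add_apply]
  refine Finset.sum_le_sum fun b _ => ?_
  rw [Finset.sum_add_distrib]
  exact perspective_negMulLog_add_le (hv b) (hle hv b) (hw b) (hle hw b)

lemma sum_homEntropy_le (s : Finset ι) {v : ι → B → ℝ} (hv : ∀ i, 0 ≤ v i) :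
    ∑ i ∈ s, homEntropy (v i) ≤ homEntropy (∑ i ∈ s, v i) := by
  classical
  induction s using Finset.induction_on with
  | empty => simp
  | insert i s hi ih =>
    rw [Finset.sum_insert hi, Finset.sum_insert hi]
    exact (add_le_add_right ih _).trans
      (homEntropy_add_le (hv i) (Finset.sum_nonneg fun i _ => hv i))

end HomEntropy

/-! ### Expectations and laws on a finite probability space -/

section Expectation

variable {Ω A B : Type*} [Fintype Ω] [Fintype A] [Fintype B]

/-- The expectation `E[F]` of a real random variable on the finite probability space `(Ω, p)`. -/
def expect (p : Distr Ω) (F : Ω → ℝ) : ℝ := ∑ ω, p ω * F ω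

/-- The probability `P(X = a)`. -/
def prob (p : Distr Ω) (X : Ω → A) (a : A) : ℝ := stdSimplex.map X p a

lemma expect_const (p : Distr Ω) (c : ℝ) : expect p (fun _ => c) = c := by
  rw [expect, ← Finset.sum_mul, stdSimplex.sum_eq_one, one_mul]

lemma expect_mul_right (p : Distr Ω) (F : Ω → ℝ) (c : ℝ) :
    expect p (fun ω => F ω * c) = expect p F * c := by
  simp only [expect, Finset.sum_mul, mul_assoc]

lemma expect_sum {ι : Type*} (p : Distr Ω) (s : Finset ι) (F : ι → Ω → ℝ) :
    expect p (fun ω => ∑ i ∈ s, F i ω) = ∑ i ∈ s, expect p (F i) := by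
  simp only [expect, Finset.mul_sum]
  exact Finset.sum_comm

lemma prob_eq_expect [DecidableEq A] (p : Distr Ω) (X : Ω → A) (a : A) :
    prob p X a = expect p fun ω => if X ω = a then 1 else 0 := by
  classical
  simp [prob, expect, stdSimplex.map_coe, FunOnFinite.linearMap_apply_apply, Finset.sum_filter]

lemma prob_congr (p : Distr Ω) {X : Ω → A} {Y : Ω → B} {a : A} {b : B}
    (h : ∀ ω, X ω = a ↔ Y ω = b) : prob p X a = prob p Y b := by
  classical
  simp only [prob_eq_expect, h]

lemma prob_nonneg (p : Distr Ω) (X : Ω → A) : 0 ≤ prob p X := fun a => (stdSimplex.map X p).2.1 a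

lemma sum_prob (p : Distr Ω) (X : Ω → A) : ∑ a, prob p X a = 1 := (stdSimplex.map X p).2.2

lemma expect_comp (p : Distr Ω) (X : Ω → A) (g : A → ℝ) :
    expect p (fun ω => g (X ω)) = ∑ a, prob p X a * g a := by
  classical
  simp only [prob_eq_expect, ← expect_mul_right, ← expect_sum]
  simp

open Classical in
lemma prob_comp (p : Distr Ω) (X : Ω → A) (g : A → B) (b : B) :
    prob p (fun ω => g (X ω)) b = ∑ a with g a = b, prob p X a := by
  rw [prob_eq_expect, expect_comp p X fun a => if g a = b then 1 else 0]
  simp [Finset.sum_filter]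

lemma sum_prob_left (p : Distr Ω) (X : Ω → A) (Y : Ω → B) (b : B) :
    ∑ a, prob p (fun ω => (X ω, Y ω)) (a, b) = prob p Y b := by
  classical
  simp only [prob_eq_expect, ← expect_sum, Prod.mk.injEq, ite_and]
  simp

lemma sum_prob_right (p : Distr Ω) (X : Ω → A) (Y : Ω → B) (a : A) :
    ∑ b, prob p (fun ω => (X ω, Y ω)) (a, b) = prob p X a := by
  classical
  simp only [prob_eq_expect, ← expect_sum, Prod.mk.injEq, ite_and]
  simp

end Expectation

/-! ### Entropy and conditional entropy -/

section Entropy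

variable {Ω A B C D : Type*} [Fintype Ω] [Fintype A] [Fintype B] [Fintype C] [Fintype D]

lemma entropy_eq_homEntropy (p : Distr Ω) (X : Ω → A) : entropy p X = homEntropy (prob p X) := by
  rw [homEntropy, sum_prob, Real.negMulLog_one, sub_zero]
  rfl

lemma entropy_eq_expect (p : Distr Ω) (X : Ω → A) :
    entropy p X = expect p fun ω => -Real.log (prob p X (X ω)) := by
  rw [expect_comp p X fun a => -Real.log (prob p X a)]
  simp [entropy, prob, negMulLog]

lemma entropy_congr (p : Distr Ω) {X : Ω → A} {Y : Ω → B}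
    (h : ∀ ω ω', X ω = X ω' ↔ Y ω = Y ω') : entropy p X = entropy p Y := by
  simp only [entropy_eq_expect, fun ω => prob_congr p fun ω' => h ω' ω]

lemma entropy_const (p : Distr Ω) (b : B) : entropy p (fun _ => b) = 0 := by
  classical
  simp [entropy_eq_expect, prob_eq_expect, expect_const]

lemma continuous_entropy (X : Ω → A) : Continuous fun p : Distr Ω => entropy p X :=
  continuous_finsetSum _ fun a _ => Real.continuous_negMulLog.comp <|
    (continuous_apply a).comp (continuous_subtype_val.comp (stdSimplex.continuous_map X))

/-- The conditional entropy `H(X|Z)`. -/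
def condEntropy (p : Distr Ω) (X : Ω → A) (Z : Ω → C) : ℝ :=
  entropy p (fun ω => (X ω, Z ω)) - entropy p Z

lemma condEntropy_eq_sum (p : Distr Ω) (X : Ω → A) (Z : Ω → C) :
    condEntropy p X Z = ∑ z, homEntropy fun x => prob p (fun ω => (X ω, Z ω)) (x, z) := by
  simp only [homEntropy, Finset.sum_sub_distrib, sum_prob_left]
  rw [condEntropy, entropy, Fintype.sum_prod_type_right]
  rfl

lemma condEntropy_congr (p : Distr Ω) {X : Ω → A} {Z : Ω → C} {X' : Ω → B} {Z' : Ω → D}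
    (hX : ∀ ω ω', (X ω = X ω' ∧ Z ω = Z ω') ↔ (X' ω = X' ω' ∧ Z' ω = Z' ω'))
    (hZ : ∀ ω ω', Z ω = Z ω' ↔ Z' ω = Z' ω') : condEntropy p X Z = condEntropy p X' Z' := by
  rw [condEntropy, condEntropy, entropy_congr p hZ,
    entropy_congr p (Y := fun ω => (X' ω, Z' ω)) (by simpa using hX)]

lemma condEntropy_le_condEntropy_comp (p : Distr Ω) (X : Ω → A) (Z : Ω → C) (g : C → D) :
    condEntropy p X Z ≤ condEntropy p X (fun ω => g (Z ω)) := by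
  classical
  have hfibre : ∀ d, (fun x => prob p (fun ω => (X ω, g (Z ω))) (x, d)) =
      ∑ z with g z = d, fun x => prob p (fun ω => (X ω, Z ω)) (x, z) := by
    intro d
    ext x
    rw [Finset.sum_apply, Finset.sum_filter,
      prob_comp p (fun ω => (X ω, Z ω)) (fun t => (t.1, g t.2)), Finset.sum_filter,
      Fintype.sum_prod_type_right]
    simp [ite_and]
  calc condEntropy p X Z
      = ∑ d, ∑ z with g z = d, homEntropy fun x => prob p (fun ω => (X ω, Z ω)) (x, z) := by
        rw [condEntropy_eq_sum]
        exact (Finset.sum_fiberwise _ g _).symm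
    _ ≤ condEntropy p X (fun ω => g (Z ω)) := by
        rw [condEntropy_eq_sum]
        refine Finset.sum_le_sum fun d _ => ?_
        rw [hfibre d]
        exact sum_homEntropy_le _ fun z x => prob_nonneg p (fun ω => (X ω, Z ω)) (x, z)

lemma condEntropy_anti (p : Distr Ω) (X : Ω → A) {Z : Ω → C} {Z' : Ω → D}
    (h : ∀ ω ω', Z' ω = Z' ω' → Z ω = Z ω') : condEntropy p X Z' ≤ condEntropy p X Z := by
  calc condEntropy p X Z' = condEntropy p X (fun ω => (Z ω, Z' ω)) :=
        condEntropy_congr p (fun ω ω' => by simp only [Prod.mk.injEq]; have := h ω ω'; tauto)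
          (fun ω ω' => by simp only [Prod.mk.injEq]; have := h ω ω'; tauto)
    _ ≤ condEntropy p X Z := condEntropy_le_condEntropy_comp p X (fun ω => (Z ω, Z' ω)) Prod.fst

lemma condEntropy_unit (p : Distr Ω) (X : Ω → A) : condEntropy p X (fun _ => ()) = entropy p X := by
  rw [condEntropy, entropy_const, sub_zero]
  exact entropy_congr p (by simp)

lemma condEntropy_le_entropy (p : Distr Ω) (X : Ω → A) (Z : Ω → C) :
    condEntropy p X Z ≤ entropy p X := by
  rw [← condEntropy_unit]
  exact condEntropy_anti p X (by simp)

lemma mutualInfo_eq (p : Distr Ω) (X : Ω → A) (Y : Ω → B) :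
    mutualInfo p X Y = entropy p Y - condEntropy p Y X := by
  rw [mutualInfo, condEntropy, entropy_congr p (X := fun ω => (Y ω, X ω))
    (Y := fun ω => (X ω, Y ω)) (by simp [and_comm])]
  ring

lemma condMutualInfo_eq (p : Distr Ω) (X : Ω → A) (Y : Ω → B) (Z : Ω → C) :
    condMutualInfo p X Y Z = condEntropy p Y Z - condEntropy p Y (fun ω => (X ω, Z ω)) := by
  rw [condMutualInfo, condEntropy, condEntropy, entropy_congr p (X := fun ω => (X ω, Y ω, Z ω))
    (Y := fun ω => (Y ω, X ω, Z ω)) (by simp only [Prod.mk.injEq]; tauto)]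
  ring

end Entropy

/-! ### Conic Carathéodory decompositions -/

section ConicCombination

variable {ι E P : Type*} [Fintype ι] [AddCommGroup E] [Module ℝ E] [AddCommGroup P] [Module ℝ P]

open Function (support)

lemma exists_add_smul_support_ssubset {q d : ι → ℝ} (hq : 0 ≤ q) (hd : support d ⊆ support q)
    (hneg : ∃ i, d i < 0) :
    ∃ t : ℝ, 0 < t ∧ 0 ≤ q + t • d ∧ support (q + t • d) ⊂ support q := by
  classical
  obtain ⟨i₀, hi₀⟩ := hneg
  obtain ⟨i, hi, hmin⟩ := Finset.exists_min_image (Finset.univ.filter fun i => d i < 0)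
    (fun i => q i / -d i) ⟨i₀, by simpa using hi₀⟩
  simp only [Finset.mem_filter, Finset.mem_univ, true_and] at hi hmin
  have hqi : 0 < q i := (hq i).lt_of_ne' (hd hi.ne)
  refine ⟨q i / -d i, div_pos hqi (neg_pos.2 hi), fun j => ?_, ?_⟩
  · rcases lt_or_ge (d j) 0 with hj | hj
    · have := (le_div_iff₀ (neg_pos.2 hj)).1 (hmin j hj)
      simp only [Pi.zero_apply, Pi.add_apply, Pi.smul_apply, smul_eq_mul]
      linarith
    · exact add_nonneg (hq j) (mul_nonneg (div_nonneg hqi.le (neg_pos.2 hi).le) hj)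
  · refine Set.ssubset_iff_exists.2 ⟨fun j hj => ?_, i, hqi.ne', ?_⟩
    · by_contra hqj
      have hdj : d j = 0 := by simpa using mt (@hd j) hqj
      simp_all
    · simp [div_neg, div_mul_cancel₀ _ hi.ne]

lemma exists_null_combination_of_not_linearIndepOn {v : ι → E} {s : Set ι}
    (h : ¬ LinearIndepOn ℝ v s) :
    ∃ d : ι → ℝ, d ≠ 0 ∧ support d ⊆ s ∧ ∑ i, d i • v i = 0 := by
  rw [linearIndepOn_iff] at h
  push Not at h
  obtain ⟨d, hds, hdv, hd0⟩ := h
  refine ⟨d, by simpa using hd0, by simpa [Finsupp.mem_supported] using hds, ?_⟩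
  rwa [Finsupp.linearCombination_apply, Finsupp.sum_fintype _ _ (by simp)] at hdv

/-- If no coefficient vector `g > 0` annihilates the family, then every linear relation has
coefficients of both signs, and moving along it in both directions splits `q` into two
combinations with fewer terms. -/
theorem mem_convexHull_linearIndepOn_support {v : ι → E}
    (hv : ∀ g : ι → ℝ, 0 ≤ g → ∑ i, g i • v i = 0 → g = 0) {q : ι → ℝ} (hq : 0 ≤ q) :
    q ∈ convexHull ℝ {q' : ι → ℝ | 0 ≤ q' ∧ ∑ i, q' i • v i = ∑ i, q i • v i ∧
      LinearIndepOn ℝ v (support q')} := by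
  induction hn : (support q).ncard using Nat.strong_induction_on generalizing q with
  | _ n ih =>
  by_cases hind : LinearIndepOn ℝ v (support q)
  · exact subset_convexHull _ _ ⟨hq, rfl, hind⟩
  obtain ⟨d, hd0, hdq, hdv⟩ := exists_null_combination_of_not_linearIndepOn hind
  have hmove : ∀ d' : ι → ℝ, d' ≠ 0 → support d' ⊆ support q → ∑ i, d' i • v i = 0 →
      ∃ t : ℝ, 0 < t ∧ q + t • -d' ∈ convexHull ℝ {q' : ι → ℝ | 0 ≤ q' ∧
        ∑ i, q' i • v i = ∑ i, q i • v i ∧ LinearIndepOn ℝ v (support q')} := by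
    intro d' hd0' hdq' hdv'
    obtain ⟨i, hi⟩ : ∃ i, -d' i < 0 := by
      by_contra! h
      have hnonneg : 0 ≤ -d' := h
      exact hd0' (neg_eq_zero.1 (hv _ hnonneg (by simp [hdv'])))
    obtain ⟨t, ht, htq, hts⟩ := exists_add_smul_support_ssubset (d := -d') hq
      (by rwa [Function.support_neg]) ⟨i, hi⟩
    have hsum : ∑ i, (q + t • -d') i • v i = ∑ i, q i • v i := by
      simp [add_smul, Finset.sum_add_distrib, mul_smul, ← Finset.smul_sum, hdv']
    have := ih _ (hn ▸ Set.ncard_lt_ncard hts) htq rfl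
    exact ⟨t, ht, by rwa [hsum] at this⟩
  obtain ⟨t, ht, htq⟩ := hmove d hd0 hdq hdv
  obtain ⟨s, hs, hsq⟩ := hmove (-d) (neg_ne_zero.2 hd0) (by rwa [Function.support_neg])
    (by simp [hdv])
  convert convex_convexHull ℝ _ htq hsq (a := s / (s + t)) (b := t / (s + t)) (by positivity)
    (by positivity) (by field_simp) using 1
  ext i
  simp only [Pi.add_apply, Pi.smul_apply, Pi.neg_apply, smul_eq_mul, neg_neg]
  field_simp
  ring

lemma exists_fin_sum_eq {α M : Type*} [Fintype α] [AddCommMonoid M] {D : Set M} (h0 : (0 : M) ∈ D)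
    {N : ℕ} (hN : Fintype.card α ≤ N) {w : α → M} (hw : ∀ i, w i ∈ D) :
    ∃ w' : Fin N → M, (∀ j, w' j ∈ D) ∧ ∑ j, w' j = ∑ i, w i := by
  classical
  obtain ⟨e⟩ : Nonempty (α ↪ Fin N) := Function.Embedding.nonempty_of_card_le (by simpa using hN)
  refine ⟨Function.extend e w 0, fun j => ?_, ?_⟩
  · rw [Function.extend_def]
    split_ifs
    exacts [hw _, h0]
  · exact (Fintype.sum_of_injective e e.injective w _ (fun j hj => Function.extend_apply' w _ j hj)
      fun i => (e.injective.extend_apply w _ i).symm).symm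

theorem sum_mem_convexHull_fin_sums [FiniteDimensional ℝ E] {D : Set P} (h0 : (0 : P) ∈ D)
    (hD : ∀ c : ℝ, 0 ≤ c → ∀ x ∈ D, c • x ∈ D) (π : P →ₗ[ℝ] E) (l : E →ₗ[ℝ] ℝ)
    (hl : ∀ x ∈ D, 0 ≤ l (π x)) (hl0 : ∀ x ∈ D, l (π x) = 0 → x = 0)
    {d : ι → P} (hd : ∀ i, d i ∈ D) {N : ℕ} (hN : Module.finrank ℝ E ≤ N) :
    ∑ i, d i ∈ convexHull ℝ {x | π x = π (∑ i, d i) ∧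
      ∃ d' : Fin N → P, (∀ j, d' j ∈ D) ∧ ∑ j, d' j = x} := by
  classical
  let T : ({i // d i ≠ 0} → ℝ) →ₗ[ℝ] P := Fintype.linearCombination ℝ fun i => d i
  have hT : ∀ q, T q = ∑ i, q i • d i := fun _ => rfl
  have hT1 : T 1 = ∑ i, d i := by
    rw [hT]
    exact Fintype.sum_of_injective _ Subtype.val_injective _ _ (by simp) (by simp)
  have hpointed : ∀ g : {i // d i ≠ 0} → ℝ, 0 ≤ g → ∑ i, g i • π (d i) = 0 → g = 0 := by
    intro g hg hsum
    have hlsum : ∑ i, g i * l (π (d i)) = 0 := by simpa using congrArg l hsum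
    ext i
    have hi := (Finset.sum_eq_zero_iff_of_nonneg
      fun i _ => mul_nonneg (hg i) (hl _ (hd i))).1 hlsum i (Finset.mem_univ i)
    exact (mul_eq_zero.1 hi).resolve_right fun h => i.2 (hl0 _ (hd i) h)
  have hmem := LinearMap.image_convexHull T _ ▸ Set.mem_image_of_mem T
    (mem_convexHull_linearIndepOn_support hpointed (zero_le_one (α := {i // d i ≠ 0} → ℝ)))
  rw [← hT1]
  refine convexHull_mono ?_ hmem
  rintro _ ⟨q, ⟨hq, hqsum, hqind⟩, rfl⟩
  refine ⟨by simpa [hT] using hqsum, ?_⟩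
  obtain ⟨d', hd', hsum⟩ := exists_fin_sum_eq h0
    (hqind.linearIndependent.fintype_card_le_finrank.trans hN)
    (w := fun i : support q => q i • d i) fun i => hD _ (hq i) _ (hd i)
  refine ⟨d', hd', hsum.trans ?_⟩
  exact Fintype.sum_of_injective _ Subtype.val_injective _ _ (by simp_all) fun _ => rfl

end ConicCombination

section ConeSpan

variable {P : Type*} [AddCommGroup P] [Module ℝ P]

lemma smul_mem_span_nnreal {D : Set P} {x : P} {c : ℝ} (hc : 0 ≤ c)
    (hx : x ∈ Submodule.span ℝ≥0 D) : c • x ∈ Submodule.span ℝ≥0 D :=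
  (Submodule.span ℝ≥0 D).smul_mem ⟨c, hc⟩ hx

lemma convex_span_nnreal (D : Set P) : Convex ℝ (Submodule.span ℝ≥0 D : Set P) :=
  fun _ hx _ hy _ _ ha hb _ =>
    add_mem (smul_mem_span_nnreal ha hx) (smul_mem_span_nnreal hb hy)

lemma exists_sum_of_mem_span_nnreal {D : Set P} (hD : ∀ c : ℝ, 0 ≤ c → ∀ x ∈ D, c • x ∈ D) {x : P}
    (hx : x ∈ Submodule.span ℝ≥0 D) :
    ∃ (n : ℕ) (d : Fin n → P), (∀ i, d i ∈ D) ∧ x = ∑ i, d i := by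
  obtain ⟨n, c, g, rfl⟩ := Submodule.mem_span_set'.1 hx
  exact ⟨n, fun i => c i • (g i : P), fun i => hD _ (c i).2 _ (g i).2, rfl⟩

end ConeSpan

/-! ### Markov chains and output entropies -/

section OutputEntropy

variable {A B B' : Type*} [Fintype A] [Fintype B] [Fintype B']

/-- The law of the function `π` of the output of the channel `K` on the (unnormalised) input
law `v`. -/
def outLaw (K : Channel A B) (π : B → B') : (A → ℝ) →ₗ[ℝ] (B' → ℝ) where
  toFun v b := ∑ a, v a * prob (K a) π b
  map_add' v w := by ext b; simp [add_mul, Finset.sum_add_distrib]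
  map_smul' c v := by ext b; simp [mul_assoc, Finset.mul_sum]

lemma outLaw_apply (K : Channel A B) (π : B → B') (v : A → ℝ) (b : B') :
    outLaw K π v b = ∑ a, v a * prob (K a) π b := rfl

lemma outLaw_nonneg (K : Channel A B) (π : B → B') {v : A → ℝ} (hv : 0 ≤ v) : 0 ≤ outLaw K π v :=
  fun b => Finset.sum_nonneg fun a _ => mul_nonneg (hv a) (prob_nonneg (K a) π b)

/-- The entropy of the function `π` of the output of the channel `K` on the (unnormalised) input
law `v`, extended homogeneously. -/
def outEntropy (K : Channel A B) (π : B → B') (v : A → ℝ) : ℝ := homEntropy (outLaw K π v)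

@[simp] lemma outEntropy_zero (K : Channel A B) (π : B → B') : outEntropy K π 0 = 0 := by
  simp [outEntropy]

lemma outEntropy_smul (K : Channel A B) (π : B → B') (c : ℝ) (v : A → ℝ) :
    outEntropy K π (c • v) = c * outEntropy K π v := by
  rw [outEntropy, map_smul, homEntropy_smul, outEntropy]

lemma sum_outEntropy_le {ι : Type*} (s : Finset ι) (K : Channel A B) (π : B → B')
    {v : ι → A → ℝ} (hv : ∀ i, 0 ≤ v i) :
    ∑ i ∈ s, outEntropy K π (v i) ≤ outEntropy K π (∑ i ∈ s, v i) := by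
  rw [outEntropy, map_sum]
  exact sum_homEntropy_le s fun i => outLaw_nonneg K π (hv i)

/-- The conditional entropy, given the input, of the function `π` of the output of the channel `K`
on the input law `v`. -/
def noiseEntropy (K : Channel A B) (π : B → B') (v : A → ℝ) : ℝ :=
  ∑ a, v a * homEntropy (prob (K a) π)

lemma noiseEntropy_smul (K : Channel A B) (π : B → B') (c : ℝ) (v : A → ℝ) :
    noiseEntropy K π (c • v) = c * noiseEntropy K π v := by
  simp [noiseEntropy, Finset.mul_sum, mul_assoc]

lemma noiseEntropy_sum {ι : Type*} (s : Finset ι) (K : Channel A B) (π : B → B') (v : ι → A → ℝ) :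
    noiseEntropy K π (∑ i ∈ s, v i) = ∑ i ∈ s, noiseEntropy K π (v i) := by
  simp only [noiseEntropy, Finset.sum_apply, Finset.sum_mul]
  exact Finset.sum_comm

end OutputEntropy

section Markov

variable {Ω A B B' C C' : Type*} [Fintype Ω] [Fintype B]

/-- `Z — X — Y` is a Markov chain, `Y` being the output of the channel `K` on the input `X`. -/
def IsMarkov (p : Distr Ω) (Z : Ω → C) (X : Ω → A) (Y : Ω → B) (K : Channel A B) : Prop :=
  ∀ F : C → A → B → ℝ, expect p (fun ω => F (Z ω) (X ω) (Y ω)) =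
    expect p fun ω => expect (K (X ω)) (F (Z ω) (X ω))

variable {p : Distr Ω} {Z : Ω → C} {X : Ω → A} {Y : Ω → B} {K : Channel A B}

lemma IsMarkov.comp (h : IsMarkov p Z X Y K) (g : C → C') :
    IsMarkov p (fun ω => g (Z ω)) X Y K :=
  fun F => h fun c => F (g c)

variable [Fintype A] [Fintype B'] [Fintype C]

lemma IsMarkov.prob_output_input (h : IsMarkov p Z X Y K) (π : B → B') (b : B') (a : A) (z : C) :
    prob p (fun ω => (π (Y ω), X ω, Z ω)) (b, a, z) =
      prob p (fun ω => (Z ω, X ω)) (z, a) * prob (K a) π b := by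
  classical
  simp only [prob_eq_expect, ← expect_mul_right]
  rw [h fun z' a' b' => if (π b', a', z') = (b, a, z) then 1 else 0]
  refine congrArg _ (funext fun ω => ?_)
  by_cases hω : Z ω = z ∧ X ω = a
  · simp [hω]
  · have hω' : ¬ (X ω = a ∧ Z ω = z) := fun h' => hω h'.symm
    simp [hω, hω', expect_const]

lemma IsMarkov.prob_output (h : IsMarkov p Z X Y K) (π : B → B') (b : B') (z : C) :
    prob p (fun ω => (π (Y ω), Z ω)) (b, z) =
      outLaw K π (fun a => prob p (fun ω => (Z ω, X ω)) (z, a)) b := by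
  simp only [outLaw_apply, ← h.prob_output_input]
  rw [← sum_prob_left p X]
  exact Finset.sum_congr rfl fun a _ => prob_congr p (by simp only [Prod.mk.injEq]; tauto)

lemma IsMarkov.condEntropy_output (h : IsMarkov p Z X Y K) (π : B → B') :
    condEntropy p (fun ω => π (Y ω)) Z =
      ∑ z, outEntropy K π fun a => prob p (fun ω => (Z ω, X ω)) (z, a) := by
  simp only [condEntropy_eq_sum, h.prob_output, outEntropy]

lemma IsMarkov.condEntropy_output_input (h : IsMarkov p Z X Y K) (π : B → B') :
    condEntropy p (fun ω => π (Y ω)) (fun ω => (X ω, Z ω)) = noiseEntropy K π (prob p X) := by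
  rw [condEntropy_eq_sum, noiseEntropy, Fintype.sum_prod_type]
  simp only [h.prob_output_input, ← sum_prob_left p Z X, Finset.sum_mul, ← homEntropy_smul]
  rfl

lemma IsMarkov.entropy_output {D : Type*} {Z : Ω → D} (h : IsMarkov p Z X Y K) (π : B → B') :
    entropy p (fun ω => π (Y ω)) = outEntropy K π (prob p X) := by
  have hlaw : prob p (fun ω => π (Y ω)) =
      outLaw K π (∑ z, fun a => prob p (fun ω => ((), X ω)) (z, a)) := by
    ext b
    rw [← sum_prob_right p _ fun _ => (), map_sum, Finset.sum_apply]
    simp only [(h.comp fun _ => ()).prob_output]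
  rw [entropy_eq_homEntropy, hlaw, outEntropy]
  congr 2
  ext a
  rw [Finset.sum_apply, sum_prob_left]

end Markov

/-! ### The cone of conditional output entropies -/

section Cone

variable {A B₁ B₂ C₁ C₂ : Type*} [Fintype A] [Fintype B₁] [Fintype B₂] [Fintype C₁] [Fintype C₂]

/-- The space of an input law, followed by the pairs of conditional entropies of the two outputs
given `C₀`, given `(C₀, C₁)` and given `(C₀, C₂)`. -/
abbrev EntropySpace (A : Type*) : Type _ := (A → ℝ) × (ℝ × ℝ) × (ℝ × ℝ) × (ℝ × ℝ)

/-- The entropies of the two outputs of the broadcast channel `K` on the (unnormalised) input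
law `v`. -/
def outPair (K : Channel A (B₁ × B₂)) (v : A → ℝ) : ℝ × ℝ :=
  (outEntropy K Prod.fst v, outEntropy K Prod.snd v)

/-- The conditional entropies, given the input, of the two outputs of the broadcast channel `K`
on the (unnormalised) input law `v`. -/
def noisePair (K : Channel A (B₁ × B₂)) (v : A → ℝ) : ℝ × ℝ :=
  (noiseEntropy K Prod.fst v, noiseEntropy K Prod.snd v)

/-- The contribution to the entropy vector of one letter of `C₀`, when `C₁` and `C₂` decompose the
input law on that letter into the families `w₁` and `w₂`. -/
def fibrePoint (K : Channel A (B₁ × B₂)) (w₁ : C₁ → A → ℝ) (w₂ : C₂ → A → ℝ) : EntropySpace A :=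
  (∑ c, w₁ c, outPair K (∑ c, w₁ c), ∑ c, outPair K (w₁ c), ∑ c, outPair K (w₂ c))

/-- The contributions of one letter of `C₀` when `C₁` and `C₂` have `|A|` letters. -/
def fibres (K : Channel A (B₁ × B₂)) : Set (EntropySpace A) :=
  {x | ∃ w₁ w₂ : Fin (Fintype.card A) → A → ℝ, 0 ≤ w₁ ∧ 0 ≤ w₂ ∧
    ∑ c, w₁ c = ∑ c, w₂ c ∧ fibrePoint K w₁ w₂ = x}

/-- The convex cone generated by the contributions of single letters of `C₀`. -/
def entropyCone (K : Channel A (B₁ × B₂)) : Submodule ℝ≥0 (EntropySpace A) :=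
  Submodule.span ℝ≥0 (fibres K)

variable (K : Channel A (B₁ × B₂))

@[simp] lemma outPair_zero : outPair K 0 = 0 := by simp [outPair]

lemma outPair_smul (c : ℝ) (v : A → ℝ) : outPair K (c • v) = c • outPair K v := by
  simp [outPair, outEntropy_smul]

lemma noisePair_smul (c : ℝ) (v : A → ℝ) : noisePair K (c • v) = c • noisePair K v := by
  simp [noisePair, noiseEntropy_smul]

lemma fibrePoint_smul (c : ℝ) (w₁ : C₁ → A → ℝ) (w₂ : C₂ → A → ℝ) :
    fibrePoint K (c • w₁) (c • w₂) = c • fibrePoint K w₁ w₂ := by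
  simp only [fibrePoint, Pi.smul_apply, ← Finset.smul_sum, outPair_smul, Prod.smul_mk]

lemma zero_mem_fibres : (0 : EntropySpace A) ∈ fibres K :=
  ⟨0, 0, le_rfl, le_rfl, rfl, by simp [fibrePoint]⟩

lemma smul_mem_fibres (c : ℝ) (hc : 0 ≤ c) (x : EntropySpace A) (hx : x ∈ fibres K) :
    c • x ∈ fibres K := by
  obtain ⟨w₁, w₂, h₁, h₂, h, rfl⟩ := hx
  exact ⟨c • w₁, c • w₂, smul_nonneg hc h₁, smul_nonneg hc h₂,
    by simp [← Finset.smul_sum, h], fibrePoint_smul K c w₁ w₂⟩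

/-- The total mass of an unnormalised law. -/
def mass (A : Type*) [Fintype A] : (A → ℝ) →ₗ[ℝ] ℝ := ∑ a, LinearMap.proj a

lemma mass_nonneg {v : A → ℝ} (hv : 0 ≤ v) : 0 ≤ mass A v := by
  simpa [mass] using Finset.sum_nonneg fun a _ => hv a

lemma eq_zero_of_mass_eq_zero {v : A → ℝ} (hv : 0 ≤ v) (h : mass A v = 0) : v = 0 := by
  have hsum : ∑ a, v a = 0 := by simpa [mass] using h
  exact funext fun a =>
    (Finset.sum_eq_zero_iff_of_nonneg fun a _ => hv a).1 hsum a (Finset.mem_univ a)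

lemma mass_nonneg_of_mem_fibres (x : EntropySpace A) (hx : x ∈ fibres K) : 0 ≤ mass A x.1 := by
  obtain ⟨w₁, w₂, h₁, -, -, rfl⟩ := hx
  exact mass_nonneg (v := ∑ c, w₁ c) (Finset.sum_nonneg fun c _ => h₁ c)

lemma eq_zero_of_mem_fibres (x : EntropySpace A) (hx : x ∈ fibres K) (h0 : mass A x.1 = 0) :
    x = 0 := by
  obtain ⟨w₁, w₂, h₁, h₂, h, rfl⟩ := hx
  have hv : ∑ c, w₁ c = 0 := eq_zero_of_mass_eq_zero (Finset.sum_nonneg fun c _ => h₁ c) h0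
  have hw₁ : w₁ = 0 := funext fun c =>
    (Finset.sum_eq_zero_iff_of_nonneg fun c _ => h₁ c).1 hv c (Finset.mem_univ c)
  have hw₂ : w₂ = 0 := funext fun c =>
    (Finset.sum_eq_zero_iff_of_nonneg fun c _ => h₂ c).1 (h ▸ hv) c (Finset.mem_univ c)
  simp [hw₁, hw₂, fibrePoint]

lemma eq_zero_of_mem_entropyCone {x : EntropySpace A} (hx : x ∈ entropyCone K)
    (h0 : x.1 = 0) : x = 0 := by
  obtain ⟨n, d, hd, rfl⟩ := exists_sum_of_mem_span_nnreal (smul_mem_fibres K) hx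
  have hmass : ∑ i, mass A (d i).1 = 0 := by
    rw [← map_sum, ← Prod.fst_sum, h0, map_zero]
  refine Finset.sum_eq_zero fun i hi => eq_zero_of_mem_fibres K _ (hd i) ?_
  exact (Finset.sum_eq_zero_iff_of_nonneg
    fun i _ => mass_nonneg_of_mem_fibres K _ (hd i)).1 hmass i hi

/-- The pairs of output entropies of the decompositions of the input law `v` into `|A|` parts. -/
def decompositionPairs (v : A → ℝ) : Set (ℝ × ℝ) :=
  {y | ∃ w : Fin (Fintype.card A) → A → ℝ, 0 ≤ w ∧ ∑ c, w c = v ∧ ∑ c, outPair K (w c) = y}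

lemma sum_outPair_mem_convexHull {w : C₁ → A → ℝ} (hw : 0 ≤ w) :
    ∑ c, outPair K (w c) ∈ convexHull ℝ (decompositionPairs K (∑ c, w c)) := by
  have hmem := sum_mem_convexHull_fin_sums (D := {x | 0 ≤ x.1 ∧ x.2 = outPair K x.1})
    (by simp) (fun c hc x hx => ⟨smul_nonneg hc hx.1, by simp [hx.2, outPair_smul]⟩)
    (LinearMap.fst ℝ (A → ℝ) (ℝ × ℝ)) (mass A) (fun x hx => mass_nonneg hx.1)
    (fun x hx h => by
      have hx1 : x.1 = 0 := eq_zero_of_mass_eq_zero hx.1 h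
      exact Prod.ext hx1 (by simp [hx.2, hx1]))
    (d := fun c => (w c, outPair K (w c))) (fun c => ⟨hw c, rfl⟩) (N := Fintype.card A) (by simp)
  have himage := LinearMap.image_convexHull (LinearMap.snd ℝ (A → ℝ) (ℝ × ℝ)) _ ▸
    Set.mem_image_of_mem (LinearMap.snd ℝ (A → ℝ) (ℝ × ℝ)) hmem
  rw [LinearMap.snd_apply, Prod.snd_sum] at himage
  refine convexHull_mono ?_ himage
  rintro _ ⟨_, ⟨hx, d, hd, rfl⟩, rfl⟩
  simp only [LinearMap.fst_apply, Prod.fst_sum] at hx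
  refine ⟨fun c => (d c).1, fun c => (hd c).1, hx, ?_⟩
  simp only [LinearMap.snd_apply, Prod.snd_sum, (hd _).2]

lemma fibrePoint_mem_entropyCone {w₁ : C₁ → A → ℝ} {w₂ : C₂ → A → ℝ} (h₁ : 0 ≤ w₁) (h₂ : 0 ≤ w₂)
    (h : ∑ c, w₁ c = ∑ c, w₂ c) : fibrePoint K w₁ w₂ ∈ entropyCone K := by
  set v := ∑ c, w₁ c
  have hmem : fibrePoint K w₁ w₂ ∈ convexHull ℝ
      ({v} ×ˢ {outPair K v} ×ˢ decompositionPairs K v ×ˢ decompositionPairs K v) := by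
    simp only [convexHull_prod, convexHull_singleton]
    exact ⟨rfl, rfl, sum_outPair_mem_convexHull K h₁, h ▸ sum_outPair_mem_convexHull K h₂⟩
  refine convexHull_min ?_ (convex_span_nnreal (fibres K)) hmem
  rintro ⟨_, _, _, _⟩ ⟨rfl, rfl, ⟨u₁, hu₁, hs₁, rfl⟩, ⟨u₂, hu₂, hs₂, rfl⟩⟩
  exact Submodule.subset_span ⟨u₁, u₂, hu₁, hu₂, hs₁.trans hs₂.symm, by rw [fibrePoint, hs₁]⟩

end Cone

/-! ### Entropy vectors of auxiliary random variables -/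

section AuxiliaryVariables

variable {Ω A B₁ B₂ C C₀ C₁ C₂ : Type*} [Fintype Ω] [Fintype A] [Fintype B₁] [Fintype B₂]
  [Fintype C] [Fintype C₀] [Fintype C₁] [Fintype C₂]

/-- The conditional entropies, given `Z`, of the two components of `Y`. -/
def condEntropyPair (p : Distr Ω) (Y : Ω → B₁ × B₂) (Z : Ω → C) : ℝ × ℝ :=
  (condEntropy p (fun ω => (Y ω).1) Z, condEntropy p (fun ω => (Y ω).2) Z)

/-- The input law and the conditional output entropies of a triple of auxiliary variables. -/
def auxPoint (p : Distr Ω) (U₀ : Ω → C₀) (U₁ : Ω → C₁) (U₂ : Ω → C₂) (X : Ω → A)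
    (Y : Ω → B₁ × B₂) : EntropySpace A :=
  (prob p X, condEntropyPair p Y U₀, condEntropyPair p Y (fun ω => (U₀ ω, U₁ ω)),
    condEntropyPair p Y (fun ω => (U₀ ω, U₂ ω)))

/-- The sub-law of `X` on the event `U = u, V = c`. -/
def fibreLaw (p : Distr Ω) (U : Ω → C₀) (V : Ω → C) (X : Ω → A) (u : C₀) (c : C) (a : A) : ℝ :=
  prob p (fun ω => ((U ω, V ω), X ω)) ((u, c), a)

lemma fibreLaw_nonneg (p : Distr Ω) (U : Ω → C₀) (V : Ω → C) (X : Ω → A) (u : C₀) :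
    0 ≤ fibreLaw p U V X u :=
  fun c a => prob_nonneg p (fun ω => ((U ω, V ω), X ω)) ((u, c), a)

lemma sum_fibreLaw (p : Distr Ω) (U : Ω → C₀) (V : Ω → C) (X : Ω → A) (u : C₀) :
    ∑ c, fibreLaw p U V X u c = fun a => prob p (fun ω => (U ω, X ω)) (u, a) := by
  ext a
  rw [Finset.sum_apply, ← sum_prob_left p V]
  exact Finset.sum_congr rfl fun c _ => prob_congr p (by simp only [Prod.mk.injEq]; tauto)

variable {p : Distr Ω} {U₀ : Ω → C₀} {U₁ : Ω → C₁} {U₂ : Ω → C₂} {X : Ω → A}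
  {Y : Ω → B₁ × B₂} {K : Channel A (B₁ × B₂)}

lemma IsMarkov.condEntropyPair_eq {Z : Ω → C} (h : IsMarkov p Z X Y K) :
    condEntropyPair p Y Z = ∑ z, outPair K fun a => prob p (fun ω => (Z ω, X ω)) (z, a) :=
  Prod.ext (by simp [condEntropyPair, outPair, Prod.fst_sum, h.condEntropy_output])
    (by simp [condEntropyPair, outPair, Prod.snd_sum, h.condEntropy_output])

lemma auxPoint_eq_sum (h : IsMarkov p (fun ω => (U₀ ω, U₁ ω, U₂ ω)) X Y K) :
    auxPoint p U₀ U₁ U₂ X Y =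
      ∑ u, fibrePoint K (fibreLaw p U₀ U₁ X u) (fibreLaw p U₀ U₂ X u) := by
  have h₁ : IsMarkov p (fun ω => (U₀ ω, U₁ ω)) X Y K := h.comp fun t => (t.1, t.2.1)
  have h₂ : IsMarkov p (fun ω => (U₀ ω, U₂ ω)) X Y K := h.comp fun t => (t.1, t.2.2)
  have hlaw : prob p X = ∑ u, fun a => prob p (fun ω => (U₀ ω, X ω)) (u, a) := by
    ext a
    rw [Finset.sum_apply, sum_prob_left]
  simp only [auxPoint, fibrePoint, sum_fibreLaw, (h.comp Prod.fst).condEntropyPair_eq,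
    h₁.condEntropyPair_eq, h₂.condEntropyPair_eq, hlaw, Fintype.sum_prod_type]
  simp only [Prod.ext_iff, Prod.fst_sum, Prod.snd_sum]
  exact ⟨trivial, trivial, ⟨rfl, rfl⟩, rfl, rfl⟩

theorem auxPoint_mem_entropyCone (h : IsMarkov p (fun ω => (U₀ ω, U₁ ω, U₂ ω)) X Y K) :
    auxPoint p U₀ U₁ U₂ X Y ∈ entropyCone K := by
  rw [auxPoint_eq_sum h]
  refine Submodule.sum_mem _ fun u _ => fibrePoint_mem_entropyCone K
    (fibreLaw_nonneg p U₀ U₁ X u) (fibreLaw_nonneg p U₀ U₂ X u) ?_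
  rw [sum_fibreLaw, sum_fibreLaw]

end AuxiliaryVariables

/-! ### The ten information quantities -/

section Information

variable {Ω A B₁ B₂ C₀ C₁ C₂ : Type*} [Fintype Ω] [Fintype A] [Fintype B₁] [Fintype B₂]
  [Fintype C₀] [Fintype C₁] [Fintype C₂]

/-- The ten information quantities of arbitrary random variables: the auxiliary variables
`c₀, c₁, c₂`, the input `a` and the pair of outputs `Y`. -/
def infoVector (p : Distr Ω) (c₀ : Ω → C₀) (c₁ : Ω → C₁) (c₂ : Ω → C₂) (a : Ω → A)
    (Y : Ω → B₁ × B₂) : Fin 10 → ℝ :=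
  let y₁ : Ω → B₁ := fun ω => (Y ω).1
  let y₂ : Ω → B₂ := fun ω => (Y ω).2
  let c₀₁ : Ω → C₀ × C₁ := fun ω => (c₀ ω, c₁ ω)
  let c₀₂ : Ω → C₀ × C₂ := fun ω => (c₀ ω, c₂ ω)
  ![mutualInfo p c₀ y₁,
    mutualInfo p c₀ y₂,
    mutualInfo p c₀₁ y₁,
    mutualInfo p c₀₂ y₂,
    mutualInfo p c₀ y₁ + condMutualInfo p c₂ y₂ c₀,
    mutualInfo p c₀ y₂ + condMutualInfo p c₁ y₁ c₀,
    mutualInfo p c₀₁ y₁ + condMutualInfo p a y₂ c₀₁,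
    mutualInfo p c₀₂ y₂ + condMutualInfo p a y₁ c₀₂,
    mutualInfo p c₀ y₁ + condMutualInfo p c₂ y₂ c₀ + condMutualInfo p a y₁ c₀₂,
    mutualInfo p c₀ y₂ + condMutualInfo p c₁ y₁ c₀ + condMutualInfo p a y₂ c₀₁]

lemma measurements_eq_infoVector (θ : Channel A (C₀ × C₁ × C₂)) (p : Distr A)
    (K : Channel A (B₁ × B₂)) :
    measurements θ p K = infoVector (joint θ p K) (fun ω => ω.1.1) (fun ω => ω.1.2.1)
      (fun ω => ω.1.2.2) (fun ω => ω.2.1) (fun ω => ω.2.2) := rfl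

/-- The ten information quantities in terms of the pairs of output entropies: `e` without
conditioning, `h₀`, `h₀₁`, `h₀₂` given the auxiliary variables named in the index, and
`n = (H(Y₁|X,C₀,C₂), H(Y₂|X,C₀,C₁))`. -/
def infoCombination (e h₀ h₀₁ h₀₂ n : ℝ × ℝ) : Fin 10 → ℝ :=
  ![e.1 - h₀.1,
    e.2 - h₀.2,
    e.1 - h₀₁.1,
    e.2 - h₀₂.2,
    e.1 - h₀.1 + (h₀.2 - h₀₂.2),
    e.2 - h₀.2 + (h₀.1 - h₀₁.1),
    e.1 - h₀₁.1 + (h₀₁.2 - n.2),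
    e.2 - h₀₂.2 + (h₀₂.1 - n.1),
    e.1 - h₀.1 + (h₀.2 - h₀₂.2) + (h₀₂.1 - n.1),
    e.2 - h₀.2 + (h₀.1 - h₀₁.1) + (h₀₁.2 - n.2)]

lemma infoVector_eq_infoCombination (p : Distr Ω) (c₀ : Ω → C₀) (c₁ : Ω → C₁) (c₂ : Ω → C₂)
    (a : Ω → A) (Y : Ω → B₁ × B₂) :
    infoVector p c₀ c₁ c₂ a Y = infoCombination
      (entropy p fun ω => (Y ω).1, entropy p fun ω => (Y ω).2)
      (condEntropyPair p Y c₀) (condEntropyPair p Y fun ω => (c₀ ω, c₁ ω))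
      (condEntropyPair p Y fun ω => (c₀ ω, c₂ ω))
      (condEntropy p (fun ω => (Y ω).1) (fun ω => (a ω, c₀ ω, c₂ ω)),
        condEntropy p (fun ω => (Y ω).2) (fun ω => (a ω, c₀ ω, c₁ ω))) := by
  have h₁ : condEntropy p (fun ω => (Y ω).1) (fun ω => (c₁ ω, c₀ ω)) =
      condEntropy p (fun ω => (Y ω).1) (fun ω => (c₀ ω, c₁ ω)) :=
    condEntropy_congr p (by simp [and_comm]) (by simp [and_comm])
  have h₂ : condEntropy p (fun ω => (Y ω).2) (fun ω => (c₂ ω, c₀ ω)) =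
      condEntropy p (fun ω => (Y ω).2) (fun ω => (c₀ ω, c₂ ω)) :=
    condEntropy_congr p (by simp [and_comm]) (by simp [and_comm])
  simp only [infoVector, mutualInfo_eq, condMutualInfo_eq, h₁, h₂]
  rfl

/-- Each quantity depends on the components of a pair `h` only through their difference and,
decreasingly, one of them; this is what makes the Csiszár sum identity applicable. -/
lemma infoCombination_le {e e' h₀ h₀' h₀₁ h₀₁' h₀₂ h₀₂' n n' : ℝ × ℝ} (he : e ≤ e')
    (h₀_le : h₀' ≤ h₀) (h₀_sub : h₀'.1 - h₀'.2 = h₀.1 - h₀.2)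
    (h₀₁_le : h₀₁'.1 ≤ h₀₁.1) (h₀₁_sub : h₀₁'.1 - h₀₁'.2 = h₀₁.1 - h₀₁.2)
    (h₀₂_le : h₀₂'.2 ≤ h₀₂.2) (h₀₂_sub : h₀₂'.1 - h₀₂'.2 = h₀₂.1 - h₀₂.2) (hn : n' ≤ n) :
    infoCombination e h₀ h₀₁ h₀₂ n ≤ infoCombination e' h₀' h₀₁' h₀₂' n' := by
  obtain ⟨he₁, he₂⟩ := he
  obtain ⟨h₀_le₁, -⟩ := h₀_le
  obtain ⟨hn₁, hn₂⟩ := hn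
  intro j
  fin_cases j <;> simp [infoCombination] <;> linarith

/-- The ten information quantities as functions of the entropy vector. -/
def infoBounds (K : Channel A (B₁ × B₂)) (x : EntropySpace A) : Fin 10 → ℝ :=
  infoCombination (outPair K x.1) x.2.1 x.2.2.1 x.2.2.2 (noisePair K x.1)

lemma IsMarkov.infoVector_eq {p : Distr Ω} {U₀ : Ω → C₀} {U₁ : Ω → C₁} {U₂ : Ω → C₂} {X : Ω → A}
    {Y : Ω → B₁ × B₂} {K : Channel A (B₁ × B₂)}
    (h : IsMarkov p (fun ω => (U₀ ω, U₁ ω, U₂ ω)) X Y K) :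
    infoVector p U₀ U₁ U₂ X Y = infoBounds K (auxPoint p U₀ U₁ U₂ X Y) := by
  have h₁ : IsMarkov p (fun ω => (U₀ ω, U₁ ω)) X Y K := h.comp fun t => (t.1, t.2.1)
  have h₂ : IsMarkov p (fun ω => (U₀ ω, U₂ ω)) X Y K := h.comp fun t => (t.1, t.2.2)
  rw [infoVector_eq_infoCombination, h.entropy_output Prod.fst, h.entropy_output Prod.snd,
    h₂.condEntropy_output_input Prod.fst, h₁.condEntropy_output_input Prod.snd]
  rfl

variable (K : Channel A (B₁ × B₂))

lemma infoBounds_smul (c : ℝ) (x : EntropySpace A) :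
    infoBounds K (c • x) = c • infoBounds K x := by
  ext j
  fin_cases j <;> simp [infoBounds, infoCombination, outPair_smul, noisePair_smul] <;> ring

lemma infoBounds_convexComb {x y : EntropySpace A} (h : x.1 = y.1) {a b : ℝ} (hab : a + b = 1) :
    infoBounds K (a • x + b • y) = a • infoBounds K x + b • infoBounds K y := by
  have hlaw : (a • x + b • y).1 = y.1 := by simp [h, ← add_smul, hab]
  obtain rfl : b = 1 - a := by linarith
  ext j
  simp only [infoBounds, hlaw, h]
  fin_cases j <;> simp [infoCombination] <;> ring

/-- All coordinates of the entropy vector except the entropy of the second output given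
`(C₀, C₁)`. -/
def keptCoords (A : Type*) :
    EntropySpace A →ₗ[ℝ] (A → ℝ) × (ℝ × ℝ) × ℝ × (ℝ × ℝ) :=
  LinearMap.id.prodMap (LinearMap.id.prodMap ((LinearMap.fst ℝ ℝ ℝ).prodMap LinearMap.id))

/-- The entropy of the second output given `(C₀, C₁)`, in which the information quantities are
nondecreasing: it need not be preserved when the alphabet of `C₀` is reduced. -/
def freeCoord (A : Type*) : EntropySpace A →ₗ[ℝ] ℝ :=
  LinearMap.snd ℝ ℝ ℝ ∘ₗ LinearMap.fst ℝ _ _ ∘ₗ LinearMap.snd ℝ _ _ ∘ₗ LinearMap.snd ℝ _ _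

lemma infoBounds_mono {x y : EntropySpace A} (h : keptCoords A x = keptCoords A y)
    (hle : freeCoord A x ≤ freeCoord A y) : infoBounds K x ≤ infoBounds K y := by
  simp only [keptCoords, freeCoord, LinearMap.prodMap_apply, Prod.ext_iff, LinearMap.id_apply,
    LinearMap.fst_apply, LinearMap.comp_apply, LinearMap.snd_apply] at h hle
  obtain ⟨h0, ⟨h1, h2⟩, h3, h4, h5⟩ := h
  intro j
  fin_cases j <;> simp [infoBounds, infoCombination, *]

end Information

/-! ### Entropy vectors and test channels -/

section TestChannels

variable {A B₁ B₂ C C₀ C₁ C₂ : Type*} [Fintype A] [Fintype B₁] [Fintype B₂]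
  [Fintype C] [Fintype C₀] [Fintype C₁] [Fintype C₂]

lemma exists_coupling {u : C₁ → ℝ} {v : C₂ → ℝ} (hu : 0 ≤ u) (hv : 0 ≤ v)
    (h : ∑ c, u c = ∑ c, v c) :
    ∃ w : C₁ → C₂ → ℝ, 0 ≤ w ∧ (∀ c₁, ∑ c₂, w c₁ c₂ = u c₁) ∧ ∀ c₂, ∑ c₁, w c₁ c₂ = v c₂ := by
  have hu0 : 0 ≤ ∑ c, u c := Finset.sum_nonneg fun c _ => hu c
  refine ⟨fun c₁ c₂ => u c₁ * v c₂ / ∑ c, u c,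
    fun c₁ c₂ => div_nonneg (mul_nonneg (hu c₁) (hv c₂)) hu0, fun c₁ => ?_, fun c₂ => ?_⟩
  · rw [← Finset.sum_div, ← Finset.mul_sum, ← h]
    exact mul_div_cancel_of_imp fun h0 =>
      (Finset.sum_eq_zero_iff_of_nonneg fun c _ => hu c).1 h0 c₁ (Finset.mem_univ _)
  · rw [← Finset.sum_div, ← Finset.sum_mul, h, mul_comm]
    exact mul_div_cancel_of_imp fun h0 =>
      (Finset.sum_eq_zero_iff_of_nonneg fun c _ => hv c).1 h0 c₂ (Finset.mem_univ _)

lemma Distr.exists_ne_zero (p : Distr A) : ∃ a, p a ≠ 0 := by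
  by_contra! h
  simpa [h] using stdSimplex.sum_eq_one p

lemma exists_channel_of_joint (p : Distr A) {w : A → C → ℝ} (hw : 0 ≤ w)
    (hs : ∀ a, ∑ c, w a c = p a) : ∃ θ : Channel A C, ∀ a c, θ a c * p a = w a c := by
  obtain ⟨a₀, ha₀⟩ := p.exists_ne_zero
  have : Nonempty C := by
    by_contra! hC
    exact ha₀ (by rw [← hs, Finset.univ_eq_empty, Finset.sum_empty])
  suffices h : ∀ a, ∃ q : Distr C, ∀ c, q c * p a = w a c from Classical.skolem.1 h
  intro a
  rcases eq_or_ne (p a) 0 with ha | ha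
  · obtain ⟨q⟩ : Nonempty (Distr C) := inferInstance
    refine ⟨q, fun c => ?_⟩
    rw [ha, mul_zero, (Finset.sum_eq_zero_iff_of_nonneg fun c _ => hw a c).1 ((hs a).trans ha) c
      (Finset.mem_univ c)]
  · exact ⟨⟨fun c => w a c / p a, fun c => div_nonneg (hw a c) (p.2.1 a),
      by rw [← Finset.sum_div, hs, div_self ha]⟩, fun c => div_mul_cancel₀ _ ha⟩

section Joint

variable (θ : Channel A (C₀ × C₁ × C₂)) (p : Distr A) (K : Channel A (B₁ × B₂))

lemma expect_joint (F : (C₀ × C₁ × C₂) × A × (B₁ × B₂) → ℝ) :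
    expect (joint θ p K) F =
      expect p fun a => expect (θ a) fun c => expect (K a) fun b => F (c, a, b) := by
  simp only [expect, Finset.mul_sum]
  rw [Fintype.sum_prod_type_right, Fintype.sum_prod_type]
  refine Finset.sum_congr rfl fun a _ => ?_
  rw [Finset.sum_comm]
  exact Finset.sum_congr rfl fun c _ => Finset.sum_congr rfl fun b _ => by
    rw [← mul_assoc, ← mul_assoc, mul_comm (p a)]
    rfl

lemma prob_joint_input (c : C₀ × C₁ × C₂) (a : A) :
    prob (joint θ p K) (fun ω => (ω.1, ω.2.1)) (c, a) = θ a c * p a := by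
  classical
  rw [prob_eq_expect]
  calc expect (joint θ p K) (fun ω => if (ω.1, ω.2.1) = (c, a) then 1 else 0)
      = expect p fun a' => expect (θ a') fun c' => expect (K a') fun _ =>
          if (c', a') = (c, a) then 1 else 0 := expect_joint θ p K _
    _ = θ a c * p a := by
        simp only [expect_const, Prod.mk.injEq, ite_and]
        simp [expect, mul_comm]

lemma prob_joint_letter : prob (joint θ p K) (fun ω => ω.2.1) = p := by
  ext a
  rw [← sum_prob_left (joint θ p K) (fun ω => ω.1)]
  simp only [prob_joint_input, ← Finset.sum_mul, stdSimplex.sum_eq_one, one_mul]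

lemma isMarkov_joint :
    IsMarkov (joint θ p K) (fun ω => (ω.1.1, ω.1.2.1, ω.1.2.2)) (fun ω => ω.2.1)
      (fun ω => ω.2.2) K := fun F => by
  simp only [expect_joint, expect_const]

/-- The entropy vector of a test channel. -/
def channelPoint : EntropySpace A :=
  auxPoint (joint θ p K) (fun ω => ω.1.1) (fun ω => ω.1.2.1) (fun ω => ω.1.2.2) (fun ω => ω.2.1)
    (fun ω => ω.2.2)

lemma channelPoint_mem_entropyCone : channelPoint θ p K ∈ entropyCone K :=
  auxPoint_mem_entropyCone (isMarkov_joint θ p K)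

lemma channelPoint_fst : (channelPoint θ p K).1 = p := prob_joint_letter θ p K

lemma measurements_eq_infoBounds : measurements θ p K = infoBounds K (channelPoint θ p K) :=
  (isMarkov_joint θ p K).infoVector_eq

lemma fibreLaw_joint_fst (u : C₀) (c₁ : C₁) (a : A) :
    fibreLaw (joint θ p K) (fun ω => ω.1.1) (fun ω => ω.1.2.1) (fun ω => ω.2.1) u c₁ a =
      ∑ c₂, θ a (u, c₁, c₂) * p a := by
  rw [fibreLaw, ← sum_prob_right _ _ fun ω => ω.1.2.2]
  simp only [← prob_joint_input θ p K]
  exact Finset.sum_congr rfl fun c₂ _ =>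
    prob_congr _ (by simp only [Prod.ext_iff]; tauto)

lemma fibreLaw_joint_snd (u : C₀) (c₂ : C₂) (a : A) :
    fibreLaw (joint θ p K) (fun ω => ω.1.1) (fun ω => ω.1.2.2) (fun ω => ω.2.1) u c₂ a =
      ∑ c₁, θ a (u, c₁, c₂) * p a := by
  rw [fibreLaw, ← sum_prob_right _ _ fun ω => ω.1.2.1]
  simp only [← prob_joint_input θ p K]
  exact Finset.sum_congr rfl fun c₁ _ =>
    prob_congr _ (by simp only [Prod.ext_iff]; tauto)

end Joint

variable {p : Distr A} {K : Channel A (B₁ × B₂)}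

/-- The test channel makes the second and the third auxiliary variable conditionally independent
given the first one and the input. -/
theorem exists_channelPoint_eq_sum_fibres {n : ℕ} {d : Fin n → EntropySpace A}
    (hd : ∀ i, d i ∈ fibres K) (hp : (∑ i, d i).1 = p) :
    ∃ θ : Channel A (Fin n × Fin (Fintype.card A) × Fin (Fintype.card A)),
      channelPoint θ p K = ∑ i, d i := by
  choose w₁ w₂ h₁ h₂ h hdw using hd
  have hlaw : ∀ i, (d i).1 = ∑ c, w₁ i c := fun i => by rw [← hdw]; rfl
  have hcoupling := fun i a => exists_coupling (u := fun c => w₁ i c a) (v := fun c => w₂ i c a)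
    (fun c => h₁ i c a) (fun c => h₂ i c a)
    (by simpa only [Finset.sum_apply] using congrFun (h i) a)
  choose w hw hw₁ hw₂ using hcoupling
  obtain ⟨θ, hθ⟩ := exists_channel_of_joint p (w := fun a
    (c : Fin n × Fin (Fintype.card A) × Fin (Fintype.card A)) => w c.1 a c.2.1 c.2.2)
    (fun a c => hw c.1 a c.2.1 c.2.2) fun a => by
      simp only [Fintype.sum_prod_type, hw₁, ← hp, Prod.fst_sum, Finset.sum_apply, hlaw]
  refine ⟨θ, ?_⟩
  rw [channelPoint, auxPoint_eq_sum (isMarkov_joint θ p K)]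
  refine Finset.sum_congr rfl fun i _ => ?_
  rw [← hdw i]
  congr 1
  · ext c a
    simp only [fibreLaw_joint_fst, hθ, hw₁]
  · ext c a
    simp only [fibreLaw_joint_snd, hθ, hw₂]

/-- Test channels on the input alphabet `A` whose auxiliary alphabets respect the cardinality
bounds of the theorem. -/
abbrev BoundedTest (A : Type*) [Fintype A] : Type _ :=
  Channel A (Fin (Fintype.card A + 5) × Fin (Fintype.card A) × Fin (Fintype.card A))

theorem exists_infoBounds_le_measurements {x : EntropySpace A} (hx : x ∈ entropyCone K)
    (hp : x.1 = p) : ∃ θ : BoundedTest A, infoBounds K x ≤ measurements θ p K := by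
  obtain ⟨n, d, hd, rfl⟩ := exists_sum_of_mem_span_nnreal (smul_mem_fibres K) hx
  have hmem := sum_mem_convexHull_fin_sums (zero_mem_fibres K) (smul_mem_fibres K) (keptCoords A)
    (mass A ∘ₗ LinearMap.fst ℝ _ _) (mass_nonneg_of_mem_fibres K) (eq_zero_of_mem_fibres K) hd
    (N := Fintype.card A + 5) (by simp)
  obtain ⟨y, ⟨hy, d', hd', rfl⟩, hle⟩ :=
    ((freeCoord A).convexOn convex_univ).exists_ge_of_mem_convexHull (Set.subset_univ _) hmem
  obtain ⟨θ, hθ⟩ := exists_channelPoint_eq_sum_fibres hd' ((congrArg Prod.fst hy).trans hp)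
  exact ⟨θ, by rw [measurements_eq_infoBounds, hθ]; exact infoBounds_mono K hy.symm hle⟩

theorem exists_infoBounds_le_smul_measurements {x : EntropySpace A} (hx : x ∈ entropyCone K)
    {c : ℝ} (hc : 0 ≤ c) (hp : x.1 = c • ⇑p) :
    ∃ θ : BoundedTest A, infoBounds K x ≤ c • measurements θ p K := by
  rcases hc.eq_or_lt with rfl | hc
  · have hmem : fibrePoint K (fun _ : Unit => ⇑p) (fun _ : Unit => ⇑p) ∈ entropyCone K :=
      fibrePoint_mem_entropyCone K (fun _ a => p.2.1 a) (fun _ a => p.2.1 a) rfl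
    obtain ⟨θ, -⟩ := exists_infoBounds_le_measurements hmem (p := p) (by simp [fibrePoint])
    refine ⟨θ, le_of_eq ?_⟩
    rw [eq_zero_of_mem_entropyCone K hx (by simpa using hp), ← zero_smul ℝ (0 : EntropySpace A),
      infoBounds_smul, zero_smul, zero_smul]
  · obtain ⟨θ, hθ⟩ := exists_infoBounds_le_measurements (p := p)
      (smul_mem_span_nnreal (inv_nonneg.2 hc.le) hx)
      (by rw [Prod.smul_fst, hp, inv_smul_smul₀ hc.ne'])
    exact ⟨θ, by rwa [infoBounds_smul, inv_smul_le_iff_of_pos hc] at hθ⟩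

theorem mem_convexHull_channelPoint {x : EntropySpace A} (hx : x ∈ entropyCone K) (hp : x.1 = p) :
    x ∈ convexHull ℝ {y | ∃ θ : Channel A
      (Fin (Fintype.card A) × Fin (Fintype.card A) × Fin (Fintype.card A)),
      channelPoint θ p K = y} := by
  obtain ⟨n, d, hd, rfl⟩ := exists_sum_of_mem_span_nnreal (smul_mem_fibres K) hx
  have hmem := sum_mem_convexHull_fin_sums (zero_mem_fibres K) (smul_mem_fibres K)
    (LinearMap.fst ℝ (A → ℝ) _) (mass A) (mass_nonneg_of_mem_fibres K) (eq_zero_of_mem_fibres K)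
    hd (N := Fintype.card A) (by simp)
  refine convexHull_mono ?_ hmem
  rintro _ ⟨hy, d', hd', rfl⟩
  exact exists_channelPoint_eq_sum_fibres hd' (hy.trans hp)

end TestChannels

/-! ### The Csiszár sum identity -/

section Window

variable {Ω D E Y₁ Y₂ : Type*} {n : ℕ}

lemma sum_fin_telescope (F : ℕ → ℝ) (n : ℕ) : ∑ q : Fin n, (F (q + 1) - F q) = F n - F 0 := by
  rw [Fin.sum_univ_eq_sum_range (fun i => F (i + 1) - F i) n, Finset.sum_range_sub]

/-- The variable `V` together with the first outputs before time `a` and the second outputs from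
time `b` on. -/
def window (V : Ω → D) (Y : Ω → Fin n → Y₁ × Y₂) (a b : ℕ) (ω : Ω) :
    D × ({i : Fin n // i.1 < a} → Y₁) × ({i : Fin n // b ≤ i.1} → Y₂) :=
  (V ω, fun i => (Y ω i).1, fun i => (Y ω i).2)

/-- The block of first outputs paired with the block of second outputs. -/
def blockPair (Y : Ω → Fin n → Y₁ × Y₂) (ω : Ω) : (Fin n → Y₁) × (Fin n → Y₂) :=
  (fun q => (Y ω q).1, fun q => (Y ω q).2)

lemma window_eq_iff (V : Ω → D) (Y : Ω → Fin n → Y₁ × Y₂) (a b : ℕ) (ω ω' : Ω) :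
    window V Y a b ω = window V Y a b ω' ↔ V ω = V ω' ∧
      (∀ i : Fin n, i.1 < a → (Y ω i).1 = (Y ω' i).1) ∧
      ∀ i : Fin n, b ≤ i.1 → (Y ω i).2 = (Y ω' i).2 := by
  simp [window, funext_iff]

lemma forall_lt_succ_iff (q : Fin n) (P : Fin n → Prop) :
    (∀ i : Fin n, i.1 < q.1 + 1 → P i) ↔ P q ∧ ∀ i : Fin n, i.1 < q.1 → P i := by
  simp only [Nat.lt_succ_iff_lt_or_eq, Fin.val_inj, or_imp, forall_and, forall_eq, and_comm]

lemma forall_ge_iff (q : Fin n) (P : Fin n → Prop) :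
    (∀ i : Fin n, q.1 ≤ i.1 → P i) ↔ P q ∧ ∀ i : Fin n, q.1 + 1 ≤ i.1 → P i := by
  simp only [Nat.succ_le_iff, Nat.le_iff_lt_or_eq (n := q.1), Fin.val_inj, or_imp, forall_and,
    forall_eq', and_comm]

variable [Fintype Ω] [Fintype D] [Fintype E] [Fintype Y₁] [Fintype Y₂]
  (p : Distr Ω) (V : Ω → D) (Y : Ω → Fin n → Y₁ × Y₂)

lemma condEntropy_window_fst (q : Fin n) (b : ℕ) :
    condEntropy p (fun ω => (Y ω q).1) (window V Y q b) =
      entropy p (window V Y (q + 1) b) - entropy p (window V Y q b) := by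
  rw [condEntropy]
  congr 1
  refine entropy_congr p fun ω ω' => ?_
  rw [Prod.mk.injEq, window_eq_iff, window_eq_iff, forall_lt_succ_iff]
  tauto

lemma condEntropy_window_snd (q : Fin n) (a : ℕ) :
    condEntropy p (fun ω => (Y ω q).2) (window V Y a (q + 1)) =
      entropy p (window V Y a q) - entropy p (window V Y a (q + 1)) := by
  rw [condEntropy]
  congr 1
  refine entropy_congr p fun ω ω' => ?_
  rw [Prod.mk.injEq, window_eq_iff, window_eq_iff, forall_ge_iff]
  tauto

lemma entropy_window_empty : entropy p (window V Y 0 n) = entropy p V :=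
  entropy_congr p fun ω ω' => by simp [window_eq_iff, Fin.is_lt]

lemma condEntropy_blockPair_fst : condEntropy p (fun ω => (blockPair Y ω).1) V =
    entropy p (window V Y n n) - entropy p (window V Y 0 n) := by
  rw [entropy_window_empty, condEntropy]
  congr 1
  exact entropy_congr p fun ω ω' => by simp [window_eq_iff, blockPair, funext_iff, and_comm]

lemma condEntropy_blockPair_snd : condEntropy p (fun ω => (blockPair Y ω).2) V =
    entropy p (window V Y 0 0) - entropy p (window V Y 0 n) := by
  rw [entropy_window_empty, condEntropy]
  congr 1
  exact entropy_congr p fun ω ω' => by simp [window_eq_iff, blockPair, funext_iff, and_comm]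

lemma condEntropy_fst_sub_condEntropy_snd_window (q : Fin n) :
    (condEntropyPair p (fun ω => Y ω q) (window V Y q (q + 1))).1 -
        (condEntropyPair p (fun ω => Y ω q) (window V Y q (q + 1))).2 =
      entropy p (window V Y (q + 1) (q + 1)) - entropy p (window V Y q q) := by
  rw [condEntropyPair, condEntropy_window_fst, condEntropy_window_snd, sub_sub_sub_cancel_right]

/-- The Csiszár sum identity. -/
theorem sum_condEntropyPair_window_sub :
    (∑ q, condEntropyPair p (fun ω => Y ω q) (window V Y q (q + 1))).1 -
        (∑ q, condEntropyPair p (fun ω => Y ω q) (window V Y q (q + 1))).2 =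
      (condEntropyPair p (blockPair Y) V).1 - (condEntropyPair p (blockPair Y) V).2 := by
  rw [Prod.fst_sum, Prod.snd_sum, ← Finset.sum_sub_distrib]
  simp only [condEntropy_fst_sub_condEntropy_snd_window]
  rw [sum_fin_telescope fun k => entropy p (window V Y k k), condEntropyPair,
    condEntropy_blockPair_fst, condEntropy_blockPair_snd, sub_sub_sub_cancel_right]

lemma sum_condEntropyPair_window_le :
    ∑ q, condEntropyPair p (fun ω => Y ω q) (window V Y q (q + 1)) ≤
      condEntropyPair p (blockPair Y) V := by
  have past : ∀ q : Fin n, condEntropy p (fun ω => (Y ω q).1) (window V Y q (q + 1)) ≤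
      entropy p (window V Y (q + 1) n) - entropy p (window V Y q n) := fun q => by
    rw [← condEntropy_window_fst]
    refine condEntropy_anti p _ fun ω ω' h => ?_
    rw [window_eq_iff] at h ⊢
    exact ⟨h.1, h.2.1, fun i hi => absurd hi (by omega)⟩
  have future : ∀ q : Fin n, condEntropy p (fun ω => (Y ω q).2) (window V Y q (q + 1)) ≤
      -entropy p (window V Y 0 (q + 1)) - -entropy p (window V Y 0 q) := fun q => by
    rw [neg_sub_neg, ← condEntropy_window_snd]
    refine condEntropy_anti p _ fun ω ω' h => ?_
    rw [window_eq_iff] at h ⊢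
    exact ⟨h.1, fun i hi => absurd hi (by omega), h.2.2⟩
  constructor
  · rw [Prod.fst_sum]
    refine (Finset.sum_le_sum fun q _ => past q).trans_eq ?_
    rw [sum_fin_telescope fun k => entropy p (window V Y k n)]
    exact (condEntropy_blockPair_fst p V Y).symm
  · rw [Prod.snd_sum]
    refine (Finset.sum_le_sum fun q _ => future q).trans_eq ?_
    rw [sum_fin_telescope fun k => -entropy p (window V Y 0 k), neg_sub_neg]
    exact (condEntropy_blockPair_snd p V Y).symm

lemma condEntropy_pi_le {m : ℕ} (Z : Fin m → Ω → E) :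
    condEntropy p (fun ω t => Z t ω) V ≤ ∑ t, condEntropy p (Z t) V := by
  induction m with
  | zero => simp [condEntropy, entropy_congr p (X := fun ω => (fun t => Z t ω, V ω)) (Y := V)
      (by simp [funext_iff])]
  | succ m ih =>
    have chain : condEntropy p (fun ω t => Z t ω) V =
        condEntropy p (Z 0) (fun ω => ((fun t : Fin m => Z t.succ ω), V ω)) +
          condEntropy p (fun ω (t : Fin m) => Z t.succ ω) V := by
      rw [condEntropy, condEntropy, condEntropy, sub_add_sub_cancel]
      congr 1
      refine entropy_congr p fun ω ω' => ?_
      simp only [Prod.mk.injEq, funext_iff, Fin.forall_fin_succ, and_assoc]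
    rw [Fin.sum_univ_succ, chain]
    exact add_le_add (condEntropy_anti p _ fun ω ω' h => (Prod.mk.inj h).2) (ih _)

lemma entropy_pi_le {m : ℕ} (Z : Fin m → Ω → E) :
    entropy p (fun ω t => Z t ω) ≤ ∑ t, entropy p (Z t) := by
  simpa only [condEntropy_unit] using condEntropy_pi_le p (fun _ => ()) Z

end Window

/-! ### Single-letterization of the channel side -/

section ChannelSide

variable {Ω D C₀ C₁ C₂ M X Y₁ Y₂ : Type*} [Fintype Ω] [Fintype Y₁] [Fintype Y₂] {n : ℕ}

/-- The block `Y` is the output of the memoryless channel `W` on the block `x`, without feedback: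
given the input at time `q`, the output at time `q` is independent of `R` and of the other
outputs. -/
def IsMemoryless (p : Distr Ω) (R : Ω → D) (x : Ω → Fin n → X) (Y : Ω → Fin n → Y₁ × Y₂)
    (W : Channel X (Y₁ × Y₂)) : Prop :=
  ∀ q, IsMarkov p (fun ω => (R ω, fun i : {i : Fin n // i ≠ q} => Y ω i)) (fun ω => x ω q)
    (fun ω => Y ω q) W

variable {p : Distr Ω} {R : Ω → D} {x : Ω → Fin n → X} {Y : Ω → Fin n → Y₁ × Y₂}
  {W : Channel X (Y₁ × Y₂)}

lemma IsMemoryless.comp (h : IsMemoryless p R x Y W) (g : D → M) :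
    IsMemoryless p (fun ω => g (R ω)) x Y W :=
  fun q => (h q).comp fun t => (g t.1, t.2)

lemma IsMemoryless.isMarkov_window (h : IsMemoryless p R x Y W) (q : Fin n) :
    IsMarkov p (window R Y q (q + 1)) (fun ω => x ω q) (fun ω => Y ω q) W :=
  (h q).comp fun t => (t.1,
    fun i : {i : Fin n // i.1 < q.1} => (t.2 ⟨i, Fin.ne_of_lt i.2⟩).1,
    fun i : {i : Fin n // q.1 + 1 ≤ i.1} => (t.2 ⟨i, Fin.ne_of_gt i.2⟩).2)

variable [Fintype X]

lemma IsMemoryless.entropy_block_le {Y' : Type*} [Fintype Y'] (h : IsMemoryless p R x Y W)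
    (π : Y₁ × Y₂ → Y') :
    entropy p (fun ω q => π (Y ω q)) ≤ outEntropy W π (∑ q, prob p fun ω => x ω q) := by
  refine (entropy_pi_le p fun q ω => π (Y ω q)).trans ?_
  simp only [fun q => (h q).entropy_output π]
  exact sum_outEntropy_le _ W π fun q => prob_nonneg _ _

variable [Fintype D] [Fintype C₀] [Fintype C₁] [Fintype C₂] [Fintype M]

lemma IsMarkov.noiseEntropy_le {B B' : Type*} [Fintype B] [Fintype B'] {X' : Ω → X} {Y' : Ω → B}
    {K : Channel X B} (h : IsMarkov p R X' Y' K) (π : B → B') :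
    noiseEntropy K π (prob p X') ≤ condEntropy p (fun ω => π (Y' ω)) R := by
  rw [← h.condEntropy_output_input π]
  exact condEntropy_anti p _ fun ω ω' e => (Prod.mk.inj e).2

lemma IsMemoryless.noisePair_le (h : IsMemoryless p R x Y W) :
    noisePair W (∑ q, prob p fun ω => x ω q) ≤ condEntropyPair p (blockPair Y) R := by
  rw [noisePair, noiseEntropy_sum, noiseEntropy_sum]
  refine le_trans ⟨?_, ?_⟩ (sum_condEntropyPair_window_le p R Y)
  · simp only [Prod.fst_sum]
    exact Finset.sum_le_sum fun q _ => (h.isMarkov_window q).noiseEntropy_le Prod.fst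
  · simp only [Prod.snd_sum]
    exact Finset.sum_le_sum fun q _ => (h.isMarkov_window q).noiseEntropy_le Prod.snd

/-- The entropy vector at time `q` of a block code; the common auxiliary variable is joined by the
past of the first and the future of the second output. -/
def letterPoint (p : Distr Ω) (V₀ : Ω → C₀) (V₁ : Ω → C₁) (V₂ : Ω → C₂) (x : Ω → Fin n → X)
    (Y : Ω → Fin n → Y₁ × Y₂) (q : Fin n) : EntropySpace X :=
  auxPoint p (window V₀ Y q (q + 1)) V₁ V₂ (fun ω => x ω q) (fun ω => Y ω q)

variable {V₀ : Ω → C₀} {V₁ : Ω → C₁} {V₂ : Ω → C₂} {μ : Ω → M}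

lemma letterPoint_mem_entropyCone (h : IsMemoryless p (fun ω => (V₀ ω, V₁ ω, V₂ ω)) x Y W)
    (q : Fin n) : letterPoint p V₀ V₁ V₂ x Y q ∈ entropyCone W :=
  auxPoint_mem_entropyCone <|
    (h.isMarkov_window q).comp fun t => ((t.1.1, t.2), t.1.2.1, t.1.2.2)

lemma condEntropyPair_window_prod (p : Distr Ω) (V : Ω → D) (V' : Ω → C₁)
    (Y : Ω → Fin n → Y₁ × Y₂) (q : Fin n) :
    condEntropyPair p (fun ω => Y ω q) (fun ω => (window V Y q (q + 1) ω, V' ω)) =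
      condEntropyPair p (fun ω => Y ω q) (window (fun ω => (V ω, V' ω)) Y q (q + 1)) := by
  have hiff : ∀ ω ω', (window V Y q (q + 1) ω, V' ω) = (window V Y q (q + 1) ω', V' ω') ↔
      window (fun ω => (V ω, V' ω)) Y q (q + 1) ω =
        window (fun ω => (V ω, V' ω)) Y q (q + 1) ω' := fun ω ω' => by
    simp only [window_eq_iff, Prod.mk.injEq]
    tauto
  exact Prod.ext (condEntropy_congr p (fun ω ω' => and_congr_right' (hiff ω ω')) hiff)
    (condEntropy_congr p (fun ω ω' => and_congr_right' (hiff ω ω')) hiff)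

lemma sum_letterPoint (p : Distr Ω) (V₀ : Ω → C₀) (V₁ : Ω → C₁) (V₂ : Ω → C₂) (x : Ω → Fin n → X)
    (Y : Ω → Fin n → Y₁ × Y₂) :
    ∑ q, letterPoint p V₀ V₁ V₂ x Y q = (∑ q, prob p fun ω => x ω q,
      ∑ q, condEntropyPair p (fun ω => Y ω q) (window V₀ Y q (q + 1)),
      ∑ q, condEntropyPair p (fun ω => Y ω q) (window (fun ω => (V₀ ω, V₁ ω)) Y q (q + 1)),
      ∑ q, condEntropyPair p (fun ω => Y ω q) (window (fun ω => (V₀ ω, V₂ ω)) Y q (q + 1))) := by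
  simp only [letterPoint, auxPoint, condEntropyPair_window_prod, Prod.ext_iff, Prod.fst_sum,
    Prod.snd_sum, and_self]

theorem IsMemoryless.infoVector_le
    (h : IsMemoryless p (fun ω => (μ ω, V₀ ω, V₁ ω, V₂ ω)) x Y W) :
    infoVector p V₀ V₁ V₂ μ (blockPair Y) ≤ infoBounds W (∑ q, letterPoint p V₀ V₁ V₂ x Y q) := by
  rw [infoVector_eq_infoCombination, infoBounds, sum_letterPoint]
  exact infoCombination_le
    ⟨h.entropy_block_le Prod.fst, h.entropy_block_le Prod.snd⟩
    (sum_condEntropyPair_window_le p _ Y) (sum_condEntropyPair_window_sub p _ Y)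
    (sum_condEntropyPair_window_le p _ Y).1 (sum_condEntropyPair_window_sub p _ Y)
    (sum_condEntropyPair_window_le p _ Y).2 (sum_condEntropyPair_window_sub p _ Y)
    ⟨(h.comp fun t => (t.1, t.2.1, t.2.2.2)).noisePair_le.1,
      (h.comp fun t => (t.1, t.2.1, t.2.2.1)).noisePair_le.2⟩

end ChannelSide

/-! ### Composite and product laws -/

section Products

variable {Ω A B C D R ι : Type*} [Fintype Ω] [Fintype A] [Fintype B] [Fintype C]

lemma expect_comm (p : Distr A) (q : Distr B) (F : A → B → ℝ) :
    expect p (fun a => expect q (F a)) = expect q fun b => expect p fun a => F a b := by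
  simp only [expect, Finset.mul_sum]
  rw [Finset.sum_comm]
  exact Finset.sum_congr rfl fun b _ => Finset.sum_congr rfl fun a _ => mul_left_comm _ _ _

/-- The joint law of `a`, drawn from `p`, and of the output of the channel `K` on the input `a`. -/
def compProd (p : Distr A) (K : Channel A B) : Distr (A × B) :=
  ⟨fun z => p z.1 * K z.1 z.2, fun z => mul_nonneg (p.2.1 _) ((K z.1).2.1 _), by
    simp only [Fintype.sum_prod_type, ← Finset.mul_sum, stdSimplex.sum_eq_one, mul_one]⟩

lemma expect_compProd (p : Distr A) (K : Channel A B) (F : A × B → ℝ) :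
    expect (compProd p K) F = expect p fun a => expect (K a) fun b => F (a, b) := by
  simp only [expect, Fintype.sum_prod_type, Finset.mul_sum, ← mul_assoc]
  rfl

variable [Fintype ι]

/-- The law of independent letters with laws `p i`. -/
def piDistr [DecidableEq ι] (p : ι → Distr B) : Distr (ι → B) :=
  ⟨fun z => ∏ i, p i (z i), fun z => Finset.prod_nonneg fun i _ => (p i).2.1 _, by
    rw [← Fintype.piFinset_univ, ← Finset.prod_univ_sum]
    exact Finset.prod_eq_one fun i _ => stdSimplex.sum_eq_one (p i)⟩

variable [DecidableEq ι] (p : ι → Distr B)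

lemma expect_piDistr_prod (k : ι → B → ℝ) :
    expect (piDistr p) (fun z => ∏ i, k i (z i)) = ∏ i, expect (p i) (k i) := by
  simp only [expect]
  rw [Finset.prod_univ_sum, Fintype.piFinset_univ]
  exact Finset.sum_congr rfl fun z _ => Finset.prod_mul_distrib.symm

lemma expect_piDistr_update (i : ι) (F : (ι → B) → ℝ) :
    expect (piDistr p) F =
      expect (piDistr p) fun z => expect (p i) fun b => F (Function.update z i b) := by
  let e := (Equiv.funSplitAt i B).symm
  have hlaw : ∀ b r, piDistr p (e (b, r)) = p i b * ∏ j : {j // j ≠ i}, p j (r j) := fun b r => by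
    refine (Fintype.prod_eq_mul_prod_subtype_ne _ i).trans ?_
    simp [e, fun j : {j // j ≠ i} => j.2]
  have hupdate : ∀ b b' r, Function.update (e (b, r)) i b' = e (b', r) := fun b b' r => by
    ext j
    rcases eq_or_ne j i with rfl | hj <;> simp [e, *]
  have hexpect : ∀ G, expect (piDistr p) G =
      ∑ r, (∏ j : {j // j ≠ i}, p j (r j)) * expect (p i) fun b => G (e (b, r)) := fun G => by
    rw [expect, ← e.sum_comp, Fintype.sum_prod_type_right]
    simp only [hlaw, expect, Finset.mul_sum]
    exact Finset.sum_congr rfl fun r _ => Finset.sum_congr rfl fun b _ => by ring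
  simp only [hexpect, hupdate, expect_const]

lemma expect_piDistr_apply (i : ι) (g : B → ℝ) :
    expect (piDistr p) (fun z => g (z i)) = expect (p i) g := by
  rw [expect_piDistr_update p i]
  simp only [Function.update_self, expect_const]

lemma sum_negMulLog_prod {m : ℕ} {k : B → ℝ} (hk : ∑ b, k b = 1) :
    ∑ z : Fin m → B, negMulLog (∏ t, k (z t)) = m * ∑ b, negMulLog (k b) := by
  induction m with
  | zero => simp
  | succ m ih =>
    have hprod : ∑ z : Fin m → B, ∏ t, k (z t) = 1 := by
      rw [← Fintype.piFinset_univ, ← Finset.prod_univ_sum]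
      simp [hk]
    rw [← (Fin.consEquiv fun _ => B).sum_comp, Fintype.sum_prod_type]
    simp only [Fin.consEquiv_apply, Fin.prod_univ_succ, Fin.cons_zero, Fin.cons_succ,
      Real.negMulLog_mul, Finset.sum_add_distrib, ← Finset.sum_mul, ← Finset.mul_sum, hprod, hk, ih]
    push_cast
    ring

lemma IsMarkov.compProd {p : Distr Ω} {Z : Ω → R} {X : Ω → D} {Y : Ω → B} {K : Channel D B}
    (h : IsMarkov p Z X Y K) (θ : Channel R C) :
    IsMarkov (compProd p fun ω => θ (Z ω)) (fun ω => (Z ω.1, ω.2)) (fun ω => X ω.1)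
      (fun ω => Y ω.1) K := by
  intro F
  rw [expect_compProd, expect_compProd, h fun z x y => expect (θ z) fun c => F (z, c) x y]
  simp only [expect_comm (K _) (θ _)]

end Products

/-! ### The law of a block code -/

section Code

variable {S T X Y₁ Y₂ C : Type*} [Fintype S] [Fintype Y₁] [Fintype Y₂] [Fintype C]
  {m n : ℕ} (θ : Channel S C) (pS : Distr S) (W : Channel X (Y₁ × Y₂))
  (f : (Fin m → S) → (Fin n → X))

/-- The joint law of the source block and the block of channel outputs. -/
def blockLaw : Distr ((Fin m → S) × (Fin n → Y₁ × Y₂)) :=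
  compProd (piDistr fun _ => pS) fun s => piDistr fun q => W (f s q)

/-- The joint law of the source block and the block of channel outputs, together with a block of
test variables obtained by sending the source letters over independent copies of `θ`. -/
def codeLaw : Distr (((Fin m → S) × (Fin n → Y₁ × Y₂)) × (Fin m → C)) :=
  compProd (blockLaw pS W f) fun ω => piDistr fun t => θ (ω.1 t)

lemma blockDistortion_eq_expect (g : (Fin n → Y₁ × Y₂) → Fin m → T) (w : S → T → ℝ≥0) :
    blockDistortion pS W f g w =
      1 / (m : ℝ) * ∑ t, expect (blockLaw pS W f) fun ω => (w (ω.1 t) (g ω.2 t) : ℝ) := by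
  simp only [blockDistortion, expect, Fintype.sum_prod_type]
  rfl

lemma isMemoryless_blockLaw :
    IsMemoryless (blockLaw pS W f) Prod.fst (fun ω => f ω.1) Prod.snd W := by
  intro q F
  rw [blockLaw, expect_compProd, expect_compProd]
  refine congrArg _ (funext fun s => ?_)
  rw [expect_piDistr_update _ q]
  simp only [Function.update_self, fun (y : Fin n → Y₁ × Y₂) b (i : {i : Fin n // i ≠ q}) =>
    Function.update_of_ne i.2 b y]

lemma isMemoryless_codeLaw :
    IsMemoryless (codeLaw θ pS W f) (fun ω => (ω.1.1, ω.2)) (fun ω => f ω.1.1) (fun ω => ω.1.2)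
      W := fun q =>
  ((isMemoryless_blockLaw pS W f q).compProd fun z => piDistr fun t => θ (z.1 t)).comp
    fun z => ((z.1.1, z.2), z.1.2)

lemma expect_blockLaw_letter (t : Fin m) (F : S → ℝ) :
    expect (blockLaw pS W f) (fun ω => F (ω.1 t)) = expect pS F := by
  rw [blockLaw, expect_compProd]
  simp only [expect_const, expect_piDistr_apply]

lemma prob_blockLaw_letter (t : Fin m) : prob (blockLaw pS W f) (fun ω => ω.1 t) = pS := by
  classical
  ext s
  rw [prob_eq_expect, expect_blockLaw_letter pS W f t fun a => if a = s then 1 else 0]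
  simp [expect]

lemma expect_codeLaw_prod (k : Fin m → C × S → ℝ) :
    expect (codeLaw θ pS W f) (fun ω => ∏ t, k t (ω.2 t, ω.1.1 t)) =
      ∏ t, expect pS fun s => expect (θ s) fun c => k t (c, s) := by
  rw [codeLaw, blockLaw, expect_compProd, expect_compProd]
  simp only [fun s : Fin m → S => expect_piDistr_prod (fun t => θ (s t)) fun t c => k t (c, s t),
    expect_const]
  exact expect_piDistr_prod (fun _ => pS) fun t s => expect (θ s) fun c => k t (c, s)

end Code

section CodeEntropy

variable {S T₁ T₂ X Y₁ Y₂ C₀ C₁ C₂ D E : Type*} [Fintype S] [Fintype T₁] [Fintype T₂]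
  [Fintype Y₁] [Fintype Y₂] [Fintype C₀] [Fintype C₁] [Fintype C₂] [Fintype D] [Fintype E]
  {m n : ℕ} (θ : Channel S (C₀ × C₁ × C₂)) (pS : Distr S) (Q : Channel S (T₁ × T₂))
  (W : Channel X (Y₁ × Y₂)) (f : (Fin m → S) → (Fin n → X))

lemma prob_codeLaw_iid (a : (C₀ × C₁ × C₂) × S → D) (d : Fin m → D) :
    prob (codeLaw θ pS W f) (fun ω t => a (ω.2 t, ω.1.1 t)) d =
      ∏ t, prob (joint θ pS Q) (fun ω => a (ω.1, ω.2.1)) (d t) := by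
  classical
  have hite : ∀ z : Fin m → D, (if z = d then (1 : ℝ) else 0) = ∏ t, if z t = d t then 1 else 0 :=
    fun z => by simp [Finset.prod_ite_zero, funext_iff]
  have hjoint : ∀ F : (C₀ × C₁ × C₂) × S → ℝ, expect (joint θ pS Q) (fun ω => F (ω.1, ω.2.1)) =
      expect pS fun s => expect (θ s) fun c => F (c, s) := fun F => by
    simp only [expect_joint, expect_const]
  simp only [prob_eq_expect, hite, fun t => hjoint fun z => if a z = d t then 1 else 0]
  exact expect_codeLaw_prod θ pS W f fun t z => if a z = d t then 1 else 0

lemma entropy_codeLaw_iid (a : (C₀ × C₁ × C₂) × S → D)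
    {A : ((Fin m → S) × (Fin n → Y₁ × Y₂)) × (Fin m → C₀ × C₁ × C₂) → E}
    (hA : ∀ ω ω', A ω = A ω' ↔ ∀ t, a (ω.2 t, ω.1.1 t) = a (ω'.2 t, ω'.1.1 t)) :
    entropy (codeLaw θ pS W f) A = m * entropy (joint θ pS Q) fun ω => a (ω.1, ω.2.1) := by
  rw [entropy_congr (codeLaw θ pS W f) (Y := fun ω t => a (ω.2 t, ω.1.1 t))
    (by simpa only [funext_iff] using hA)]
  refine Eq.trans ?_ (sum_negMulLog_prod (sum_prob _ _))
  exact Finset.sum_congr rfl fun d _ => congrArg _ (prob_codeLaw_iid θ pS Q W f a d)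

end CodeEntropy

/-! ### The source side of the converse -/

section Mixture

variable {Ω Ω' A B C ι : Type*} [Fintype Ω] [Fintype Ω'] [Fintype A] [Fintype B] [Fintype C]
  [Fintype ι]

lemma sum_condEntropy_le_of_mixture {p : Distr Ω} {p' : Distr Ω'} {c : ℝ} {X : Ω → A} {Z : Ω → C}
    {X' : ι → Ω' → A} {Z' : ι → Ω' → C}
    (h : ∀ F : A × C → ℝ, c * expect p (fun ω => F (X ω, Z ω)) =
      ∑ i, expect p' fun ω => F (X' i ω, Z' i ω)) :
    ∑ i, condEntropy p' (X' i) (Z' i) ≤ c * condEntropy p X Z := by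
  classical
  simp only [condEntropy_eq_sum, Finset.mul_sum]
  rw [Finset.sum_comm]
  refine Finset.sum_le_sum fun z _ => ?_
  rw [← homEntropy_smul]
  refine (sum_homEntropy_le _ fun i x => prob_nonneg p' _ (x, z)).trans_eq ?_
  refine congrArg homEntropy (funext fun x => ?_)
  rw [Finset.sum_apply, Pi.smul_apply, smul_eq_mul, prob_eq_expect]
  simp only [prob_eq_expect]
  exact (h fun y => if y = (x, z) then 1 else 0).symm

lemma condMutualInfo_comm (p : Distr Ω) (X : Ω → A) (Y : Ω → B) (Z : Ω → C) :
    condMutualInfo p X Y Z = condMutualInfo p Y X Z := by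
  rw [condMutualInfo, condMutualInfo, entropy_congr p (X := fun ω => (X ω, Y ω, Z ω))
    (Y := fun ω => (Y ω, X ω, Z ω)) (by simp only [Prod.mk.injEq]; tauto), add_comm]

lemma mutualInfo_eq_condMutualInfo (p : Distr Ω) (X : Ω → A) (Y : Ω → B) :
    mutualInfo p X Y = condMutualInfo p X Y fun _ => () := by
  rw [mutualInfo_eq, condMutualInfo_eq, condEntropy_unit]
  exact congrArg _ (condEntropy_congr p (by simp) (by simp))

end Mixture

section SourceSide

variable {S T T₁ T₂ X Y₁ Y₂ C₀ C₁ C₂ : Type*} [Fintype S] [Fintype T] [Fintype T₁] [Fintype T₂]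
  [Fintype Y₁] [Fintype Y₂] [Fintype C₀] [Fintype C₁] [Fintype C₂] {m n : ℕ}

/-- `Q` is the virtual channel from a uniformly chosen source letter to its reconstruction. -/
def IsVirtualChannel (Q : Channel S T) (pS : Distr S) (W : Channel X (Y₁ × Y₂))
    (f : (Fin m → S) → (Fin n → X)) (g : (Fin n → Y₁ × Y₂) → Fin m → T) : Prop :=
  ∀ F : S × T → ℝ, (m : ℝ) * expect pS (fun s => expect (Q s) fun r => F (s, r)) =
    ∑ t, expect (blockLaw pS W f) fun ω => F (ω.1 t, g ω.2 t)

lemma exists_isVirtualChannel (hm : 0 < m) (pS : Distr S) (W : Channel X (Y₁ × Y₂))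
    (f : (Fin m → S) → (Fin n → X)) (g : (Fin n → Y₁ × Y₂) → Fin m → T) :
    ∃ Q, IsVirtualChannel Q pS W f g := by
  have hm' : (m : ℝ) ≠ 0 := Nat.cast_ne_zero.2 hm.ne'
  obtain ⟨Q, hQ⟩ := exists_channel_of_joint pS
    (w := fun s r => (m : ℝ)⁻¹ * ∑ t, prob (blockLaw pS W f) (fun ω => (ω.1 t, g ω.2 t)) (s, r))
    (fun s r => mul_nonneg (by positivity) (Finset.sum_nonneg fun t _ => prob_nonneg _ _ _))
    fun s => by
      rw [← Finset.mul_sum, Finset.sum_comm]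
      simp only [sum_prob_right, prob_blockLaw_letter]
      simp [hm']
  refine ⟨Q, fun F => ?_⟩
  simp only [expect_comp (blockLaw pS W f) (fun ω => (ω.1 _, g ω.2 _)) F]
  rw [Finset.sum_comm, Fintype.sum_prod_type]
  simp only [expect, Finset.mul_sum, ← Finset.sum_mul]
  refine Finset.sum_congr rfl fun s _ => Finset.sum_congr rfl fun r _ => ?_
  rw [← mul_assoc (pS s), mul_comm (pS s), hQ]
  field_simp

/-- The block of pairs of reconstructions of two decoders that each see one output. -/
def pairDecoder (g₁ : (Fin n → Y₁) → (Fin m → T₁)) (g₂ : (Fin n → Y₂) → (Fin m → T₂))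
    (y : Fin n → Y₁ × Y₂) (t : Fin m) : T₁ × T₂ :=
  (g₁ (fun q => (y q).1) t, g₂ (fun q => (y q).2) t)

variable {Q : Channel S (T₁ × T₂)} {pS : Distr S} {W : Channel X (Y₁ × Y₂)}
  {f : (Fin m → S) → (Fin n → X)} {g : (Fin n → Y₁ × Y₂) → Fin m → T₁ × T₂}
  {g₁ : (Fin n → Y₁) → (Fin m → T₁)} {g₂ : (Fin n → Y₂) → (Fin m → T₂)}

lemma distortion₁_eq_expect (w : S → T₁ → ℝ≥0) :
    distortion₁ pS Q w = expect pS fun s => expect (Q s) fun r => (w s r.1 : ℝ) := by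
  simp only [distortion₁, expect, Finset.mul_sum, mul_assoc]

lemma distortion₂_eq_expect (w : S → T₂ → ℝ≥0) :
    distortion₂ pS Q w = expect pS fun s => expect (Q s) fun r => (w s r.2 : ℝ) := by
  simp only [distortion₂, expect, Finset.mul_sum, mul_assoc]

lemma IsVirtualChannel.distortion₁_eq (hQ : IsVirtualChannel Q pS W f (pairDecoder g₁ g₂))
    (hm : 0 < m) (w : S → T₁ → ℝ≥0) :
    distortion₁ pS Q w = blockDistortion pS W f (fun y => g₁ (fun q => (y q).1)) w := by
  rw [blockDistortion_eq_expect, distortion₁_eq_expect, one_div,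
    eq_inv_mul_iff_mul_eq₀ (Nat.cast_ne_zero.2 hm.ne')]
  exact hQ fun z => (w z.1 z.2.1 : ℝ)

lemma IsVirtualChannel.distortion₂_eq (hQ : IsVirtualChannel Q pS W f (pairDecoder g₁ g₂))
    (hm : 0 < m) (w : S → T₂ → ℝ≥0) :
    distortion₂ pS Q w = blockDistortion pS W f (fun y => g₂ (fun q => (y q).2)) w := by
  rw [blockDistortion_eq_expect, distortion₂_eq_expect, one_div,
    eq_inv_mul_iff_mul_eq₀ (Nat.cast_ne_zero.2 hm.ne')]
  exact hQ fun z => (w z.1 z.2.2 : ℝ)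

variable (θ : Channel S (C₀ × C₁ × C₂))

lemma IsVirtualChannel.expect_joint (hQ : IsVirtualChannel Q pS W f g)
    (F : (C₀ × C₁ × C₂) × S × (T₁ × T₂) → ℝ) :
    (m : ℝ) * expect (joint θ pS Q) F =
      ∑ t, expect (codeLaw θ pS W f) fun ω => F (ω.2 t, ω.1.1 t, g ω.1.2 t) := by
  simp only [SourceBroadcast.expect_joint, expect_comm (θ _) (Q _)]
  rw [hQ fun z => expect (θ z.1) fun c => F (c, z)]
  refine Finset.sum_congr rfl fun t _ => ?_
  rw [codeLaw, expect_compProd]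
  congr 1
  ext ω
  exact (expect_piDistr_apply (fun t => θ (ω.1 t)) t fun c => F (c, ω.1 t, g ω.2 t)).symm

/-- The information is expanded around the letters, which are i.i.d., so that their conditional
entropy given `b` single-letterizes with equality. -/
theorem IsVirtualChannel.condMutualInfo_le (hQ : IsVirtualChannel Q pS W f g)
    {D D' E E' R Y' : Type*} [Fintype D] [Fintype D'] [Fintype E] [Fintype E'] [Fintype R]
    [Fintype Y'] (a : (C₀ × C₁ × C₂) × S → D) (b : (C₀ × C₁ × C₂) × S → D')
    {A : ((Fin m → S) × (Fin n → Y₁ × Y₂)) × (Fin m → C₀ × C₁ × C₂) → E}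
    {B : ((Fin m → S) × (Fin n → Y₁ × Y₂)) × (Fin m → C₀ × C₁ × C₂) → E'}
    (hA : ∀ ω ω', A ω = A ω' ↔ ∀ t, a (ω.2 t, ω.1.1 t) = a (ω'.2 t, ω'.1.1 t))
    (hB : ∀ ω ω', B ω = B ω' ↔ ∀ t, b (ω.2 t, ω.1.1 t) = b (ω'.2 t, ω'.1.1 t))
    (π : T₁ × T₂ → R) (η : Y₁ × Y₂ → Y')
    (hη : ∀ y y', (∀ q, η (y q) = η (y' q)) → ∀ t, π (g y t) = π (g y' t)) :
    m * condMutualInfo (joint θ pS Q) (fun ω => a (ω.1, ω.2.1)) (fun ω => π ω.2.2)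
        (fun ω => b (ω.1, ω.2.1)) ≤
      condMutualInfo (codeLaw θ pS W f) A (fun ω q => η (ω.1.2 q)) B := by
  have iid : condEntropy (codeLaw θ pS W f) A B =
      m * condEntropy (joint θ pS Q) (fun ω => a (ω.1, ω.2.1)) (fun ω => b (ω.1, ω.2.1)) := by
    rw [condEntropy, condEntropy, mul_sub, entropy_codeLaw_iid θ pS Q W f b hB,
      entropy_codeLaw_iid θ pS Q W f (fun z => (a z, b z)) (A := fun ω => (A ω, B ω)) fun ω ω' => by
        simp only [Prod.mk.injEq, hA, hB, forall_and]]
  rw [condMutualInfo_comm, condMutualInfo_comm (codeLaw θ pS W f), condMutualInfo_eq,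
    condMutualInfo_eq, iid, mul_sub]
  refine sub_le_sub_left ?_ _
  calc condEntropy (codeLaw θ pS W f) A (fun ω => (fun q => η (ω.1.2 q), B ω))
      = condEntropy (codeLaw θ pS W f) (fun ω t => a (ω.2 t, ω.1.1 t))
          (fun ω => (fun q => η (ω.1.2 q), B ω)) :=
        condEntropy_congr _ (fun ω ω' => by simp only [funext_iff, hA]) fun _ _ => Iff.rfl
    _ ≤ ∑ t, condEntropy (codeLaw θ pS W f) (fun ω => a (ω.2 t, ω.1.1 t))
          (fun ω => (fun q => η (ω.1.2 q), B ω)) := condEntropy_pi_le _ _ _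
    _ ≤ ∑ t, condEntropy (codeLaw θ pS W f) (fun ω => a (ω.2 t, ω.1.1 t))
          (fun ω => (π (g ω.1.2 t), b (ω.2 t, ω.1.1 t))) :=
        Finset.sum_le_sum fun t _ => condEntropy_anti _ _ fun ω ω' h => by
          obtain ⟨hy, hb⟩ := Prod.mk.inj h
          exact Prod.ext (hη _ _ (congrFun hy) t) ((hB _ _).1 hb t)
    _ ≤ m * condEntropy (joint θ pS Q) (fun ω => a (ω.1, ω.2.1))
          (fun ω => (π ω.2.2, b (ω.1, ω.2.1))) :=
        sum_condEntropy_le_of_mixture fun F =>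
          hQ.expect_joint θ fun ω => F (a (ω.1, ω.2.1), π ω.2.2, b (ω.1, ω.2.1))

theorem IsVirtualChannel.mutualInfo_le (hQ : IsVirtualChannel Q pS W f g)
    {D E R Y' : Type*} [Fintype D] [Fintype E] [Fintype R] [Fintype Y']
    (a : (C₀ × C₁ × C₂) × S → D)
    {A : ((Fin m → S) × (Fin n → Y₁ × Y₂)) × (Fin m → C₀ × C₁ × C₂) → E}
    (hA : ∀ ω ω', A ω = A ω' ↔ ∀ t, a (ω.2 t, ω.1.1 t) = a (ω'.2 t, ω'.1.1 t))
    (π : T₁ × T₂ → R) (η : Y₁ × Y₂ → Y')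
    (hη : ∀ y y', (∀ q, η (y q) = η (y' q)) → ∀ t, π (g y t) = π (g y' t)) :
    m * mutualInfo (joint θ pS Q) (fun ω => a (ω.1, ω.2.1)) (fun ω => π ω.2.2) ≤
      mutualInfo (codeLaw θ pS W f) A (fun ω q => η (ω.1.2 q)) := by
  simp only [mutualInfo_eq_condMutualInfo]
  exact hQ.condMutualInfo_le θ a (fun _ => ()) hA (by simp) π η hη

theorem IsVirtualChannel.measurements_le (hQ : IsVirtualChannel Q pS W f (pairDecoder g₁ g₂)) :
    (m : ℝ) • measurements θ pS Q ≤ infoVector (codeLaw θ pS W f) (fun ω t => (ω.2 t).1)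
      (fun ω t => (ω.2 t).2.1) (fun ω t => (ω.2 t).2.2) (fun ω => ω.1.1)
      (blockPair fun ω => ω.1.2) := by
  have hfst : ∀ y y' : Fin n → Y₁ × Y₂, (∀ q, (y q).1 = (y' q).1) →
      ∀ t, (pairDecoder g₁ g₂ y t).1 = (pairDecoder g₁ g₂ y' t).1 := fun y y' h t => by
    simp only [pairDecoder, h]
  have hsnd : ∀ y y' : Fin n → Y₁ × Y₂, (∀ q, (y q).2 = (y' q).2) →
      ∀ t, (pairDecoder g₁ g₂ y t).2 = (pairDecoder g₁ g₂ y' t).2 := fun y y' h t => by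
    simp only [pairDecoder, h]
  have h₀₁ : ∀ ω ω' : ((Fin m → S) × (Fin n → Y₁ × Y₂)) × (Fin m → C₀ × C₁ × C₂),
      ((fun t => (ω.2 t).1, fun t => (ω.2 t).2.1) : (Fin m → C₀) × (Fin m → C₁)) =
        (fun t => (ω'.2 t).1, fun t => (ω'.2 t).2.1) ↔
      ∀ t, ((ω.2 t).1, (ω.2 t).2.1) = ((ω'.2 t).1, (ω'.2 t).2.1) := fun ω ω' => by
    simp only [Prod.mk.injEq, funext_iff, forall_and]
  have h₀₂ : ∀ ω ω' : ((Fin m → S) × (Fin n → Y₁ × Y₂)) × (Fin m → C₀ × C₁ × C₂),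
      ((fun t => (ω.2 t).1, fun t => (ω.2 t).2.2) : (Fin m → C₀) × (Fin m → C₂)) =
        (fun t => (ω'.2 t).1, fun t => (ω'.2 t).2.2) ↔
      ∀ t, ((ω.2 t).1, (ω.2 t).2.2) = ((ω'.2 t).1, (ω'.2 t).2.2) := fun ω ω' => by
    simp only [Prod.mk.injEq, funext_iff, forall_and]
  have i₀_fst := hQ.mutualInfo_le θ (·.1.1) (fun _ _ => funext_iff) Prod.fst Prod.fst hfst
  have i₀_snd := hQ.mutualInfo_le θ (·.1.1) (fun _ _ => funext_iff) Prod.snd Prod.snd hsnd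
  have i₀₁_fst := hQ.mutualInfo_le θ (fun z => (z.1.1, z.1.2.1)) h₀₁ Prod.fst Prod.fst hfst
  have i₀₂_snd := hQ.mutualInfo_le θ (fun z => (z.1.1, z.1.2.2)) h₀₂ Prod.snd Prod.snd hsnd
  have i₁_fst := hQ.condMutualInfo_le θ (·.1.2.1) (·.1.1) (fun _ _ => funext_iff)
    (fun _ _ => funext_iff) Prod.fst Prod.fst hfst
  have i₂_snd := hQ.condMutualInfo_le θ (·.1.2.2) (·.1.1) (fun _ _ => funext_iff)
    (fun _ _ => funext_iff) Prod.snd Prod.snd hsnd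
  have s_snd := hQ.condMutualInfo_le θ (·.2) (fun z => (z.1.1, z.1.2.1)) (fun _ _ => funext_iff)
    h₀₁ Prod.snd Prod.snd hsnd
  have s_fst := hQ.condMutualInfo_le θ (·.2) (fun z => (z.1.1, z.1.2.2)) (fun _ _ => funext_iff)
    h₀₂ Prod.fst Prod.fst hfst
  intro j
  fin_cases j <;>
    simp only [measurements, infoVector, blockPair, Pi.smul_apply, smul_eq_mul, Fin.reduceFinMk,
      Matrix.cons_val, Fin.zero_eta, Fin.mk_one, Fin.isValue] <;>
    linarith

end SourceSide

/-! ### Single-letterization -/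

section SingleLetter

lemma Achievable.nonneg {S T₁ T₂ X Y₁ Y₂ : Type*} [Fintype S] [Fintype Y₁] [Fintype Y₂]
    {pS : Distr S} {W : Channel X (Y₁ × Y₂)} {w₁ : S → T₁ → ℝ≥0} {w₂ : S → T₂ → ℝ≥0}
    {κ d₁ d₂ : ℝ} (h : Achievable pS W w₁ w₂ κ d₁ d₂) : 0 ≤ κ :=
  le_of_forall_pos_le_add fun ε hε => by
    obtain ⟨m, n, -, -, -, -, hmn, -⟩ := h ε hε
    exact (div_nonneg n.cast_nonneg m.cast_nonneg).trans hmn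

variable {Ω A B C S T₁ T₂ X Y₁ Y₂ C₀ C₁ C₂ : Type*} [Fintype Ω] [Fintype A] [Fintype B]
  [Fintype C] [Fintype S] [Fintype T₁] [Fintype T₂] [Fintype X] [Fintype Y₁] [Fintype Y₂]
  [Fintype C₀] [Fintype C₁] [Fintype C₂]

lemma mutualInfo_nonneg (p : Distr Ω) (X : Ω → A) (Y : Ω → B) : 0 ≤ mutualInfo p X Y := by
  rw [mutualInfo_eq]
  exact sub_nonneg.2 (condEntropy_le_entropy p Y X)

lemma condMutualInfo_nonneg (p : Distr Ω) (X : Ω → A) (Y : Ω → B) (Z : Ω → C) :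
    0 ≤ condMutualInfo p X Y Z := by
  rw [condMutualInfo_eq]
  exact sub_nonneg.2 (condEntropy_anti p Y fun _ _ h => (Prod.mk.inj h).2)

lemma infoVector_nonneg (p : Distr Ω) (c₀ : Ω → C₀) (c₁ : Ω → C₁) (c₂ : Ω → C₂) (a : Ω → A)
    (Y : Ω → Y₁ × Y₂) : 0 ≤ infoVector p c₀ c₁ c₂ a Y := by
  intro j
  fin_cases j <;>
    simp only [infoVector, Fin.reduceFinMk, Matrix.cons_val, Fin.zero_eta, Fin.mk_one,
      Fin.isValue, Pi.zero_apply] <;>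
    first
    | exact mutualInfo_nonneg _ _ _
    | exact add_nonneg (mutualInfo_nonneg _ _ _) (condMutualInfo_nonneg _ _ _ _)
    | exact add_nonneg (add_nonneg (mutualInfo_nonneg _ _ _) (condMutualInfo_nonneg _ _ _ _))
        (condMutualInfo_nonneg _ _ _ _)

lemma measurements_nonneg (θ : Channel A (C₀ × C₁ × C₂)) (p : Distr A) (K : Channel A (Y₁ × Y₂)) :
    0 ≤ measurements θ p K := by
  rw [measurements_eq_infoVector]
  exact infoVector_nonneg _ _ _ _ _ _

lemma prob_compProd_fst (p : Distr Ω) (K : Channel Ω B) (X : Ω → A) :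
    prob (compProd p K) (fun z => X z.1) = prob p X := by
  classical
  ext a
  rw [prob_eq_expect, prob_eq_expect, expect_compProd]
  simp only [fun ω => expect_const (K ω) (if X ω = a then 1 else 0)]

lemma exists_smul_eq_sum_prob [Nonempty X] {n : ℕ} (p : Distr Ω) (x : Ω → Fin n → X) :
    ∃ pX : Distr X, (n : ℝ) • ⇑pX = ∑ q, prob p fun ω => x ω q := by
  rcases n.eq_zero_or_pos with rfl | hn
  · obtain ⟨pX⟩ : Nonempty (Distr X) := inferInstance
    exact ⟨pX, by simp⟩
  · have hn' : (n : ℝ) ≠ 0 := Nat.cast_ne_zero.2 hn.ne'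
    refine ⟨⟨(n : ℝ)⁻¹ • ∑ q, prob p fun ω => x ω q, smul_nonneg (by positivity)
      (Finset.sum_nonneg fun q _ => prob_nonneg _ _), ?_⟩, smul_inv_smul₀ hn' _⟩
    simp only [Pi.smul_apply, Finset.sum_apply, smul_eq_mul, ← Finset.mul_sum]
    rw [Finset.sum_comm]
    simp [sum_prob, hn']

/-- The channel converse; for a code, `μ` is the source block and stands for the channel input in
the information quantities on the left. -/
theorem IsMemoryless.exists_infoVector_le {n : ℕ} {p : Distr Ω} {μ : Ω → A} {V₀ : Ω → C₀}
    {V₁ : Ω → C₁} {V₂ : Ω → C₂} {x : Ω → Fin n → X} {Y : Ω → Fin n → Y₁ × Y₂}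
    {W : Channel X (Y₁ × Y₂)} (h : IsMemoryless p (fun ω => (μ ω, V₀ ω, V₁ ω, V₂ ω)) x Y W)
    {pX : Distr X} (hpX : (n : ℝ) • ⇑pX = ∑ q, prob p fun ω => x ω q) :
    ∃ V : BoundedTest X, infoVector p V₀ V₁ V₂ μ (blockPair Y) ≤ (n : ℝ) • measurements V pX W := by
  have hcone : ∑ q, letterPoint p V₀ V₁ V₂ x Y q ∈ entropyCone W :=
    Submodule.sum_mem _ fun q _ => letterPoint_mem_entropyCone (h.comp Prod.snd) q
  obtain ⟨V, hV⟩ := exists_infoBounds_le_smul_measurements hcone n.cast_nonneg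
    (by rw [sum_letterPoint, hpX])
  exact ⟨V, h.infoVector_le.trans hV⟩

theorem IsVirtualChannel.exists_smul_measurements_le {m n : ℕ} {Q : Channel S (T₁ × T₂)}
    {pS : Distr S} {W : Channel X (Y₁ × Y₂)} {f : (Fin m → S) → (Fin n → X)}
    {g₁ : (Fin n → Y₁) → (Fin m → T₁)} {g₂ : (Fin n → Y₂) → (Fin m → T₂)}
    (hQ : IsVirtualChannel Q pS W f (pairDecoder g₁ g₂)) {pX : Distr X}
    (hpX : (n : ℝ) • ⇑pX = ∑ q, prob (blockLaw pS W f) fun ω => f ω.1 q)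
    (θ : Channel S (C₀ × C₁ × C₂)) :
    ∃ V : BoundedTest X, (m : ℝ) • measurements θ pS Q ≤ (n : ℝ) • measurements V pX W := by
  have memoryless : IsMemoryless (codeLaw θ pS W f) (fun ω => (ω.1.1, fun t => (ω.2 t).1,
      fun t => (ω.2 t).2.1, fun t => (ω.2 t).2.2)) (fun ω => f ω.1.1) (fun ω => ω.1.2) W :=
    (isMemoryless_codeLaw θ pS W f).comp fun z =>
      (z.1, fun t => (z.2 t).1, fun t => (z.2 t).2.1, fun t => (z.2 t).2.2)
  have hletters : (n : ℝ) • ⇑pX = ∑ q, prob (codeLaw θ pS W f) fun ω => f ω.1.1 q := by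
    rw [hpX]
    exact Finset.sum_congr rfl fun q _ => (prob_compProd_fst (blockLaw pS W f)
      (fun ω => piDistr fun t => θ (ω.1 t)) fun ω => f ω.1 q).symm
  obtain ⟨V, hV⟩ := memoryless.exists_infoVector_le hletters
  exact ⟨V, (hQ.measurements_le θ).trans hV⟩

/-- Condition `(∗)` with the auxiliary variables of the physical channel restricted to the
cardinality bounds. -/
def IsDominated (κ : ℝ) (pS : Distr S) (Q : Channel S (T₁ × T₂)) (pX : Distr X)
    (W : Channel X (Y₁ × Y₂)) : Prop :=
  ∀ (k₀ k₁ k₂ : ℕ) (U : Channel S (Fin k₀ × Fin k₁ × Fin k₂)),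
    ∃ V : BoundedTest X, measurements U pS Q ≤ κ • measurements V pX W

variable {pS : Distr S} {W : Channel X (Y₁ × Y₂)} {w₁ : S → T₁ → ℝ≥0} {w₂ : S → T₂ → ℝ≥0}
  {κ d₁ d₂ : ℝ}

theorem Achievable.exists_isDominated_add [Nonempty X] (h : Achievable pS W w₁ w₂ κ d₁ d₂) {ε : ℝ}
    (hε : 0 < ε) :
    ∃ (Q : Channel S (T₁ × T₂)) (pX : Distr X), distortion₁ pS Q w₁ ≤ d₁ + ε ∧
      distortion₂ pS Q w₂ ≤ d₂ + ε ∧ IsDominated (κ + ε) pS Q pX W := by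
  obtain ⟨m, n, f, g₁, g₂, hm, hmn, h₁, h₂⟩ := h ε hε
  obtain ⟨Q, hQ⟩ := exists_isVirtualChannel hm pS W f (pairDecoder g₁ g₂)
  obtain ⟨pX, hpX⟩ := exists_smul_eq_sum_prob (blockLaw pS W f) fun ω => f ω.1
  refine ⟨Q, pX, (hQ.distortion₁_eq hm w₁).trans_le h₁, (hQ.distortion₂_eq hm w₂).trans_le h₂,
    fun k₀ k₁ k₂ U => ?_⟩
  obtain ⟨V, hV⟩ := hQ.exists_smul_measurements_le hpX U
  have hm' : (0 : ℝ) < m := Nat.cast_pos.2 hm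
  refine ⟨V, le_trans ?_ (smul_le_smul_of_nonneg_right hmn (measurements_nonneg V pX W))⟩
  rwa [div_eq_inv_mul, mul_smul, le_inv_smul_iff_of_pos hm']

end SingleLetter

/-! ### Limits of codes -/

section Limits

lemma continuous_channel_apply {A B : Type*} [Fintype B] (a : A) (b : B) :
    Continuous fun K : Channel A B => K a b :=
  (continuous_apply b).comp (continuous_subtype_val.comp (continuous_apply a))

variable {Ω A B C B₁ B₂ C₀ C₁ C₂ : Type*} [Fintype Ω] [Fintype A] [Fintype B] [Fintype C]
  [Fintype B₁] [Fintype B₂] [Fintype C₀] [Fintype C₁] [Fintype C₂]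

lemma continuous_mutualInfo (X : Ω → A) (Y : Ω → B) :
    Continuous fun p : Distr Ω => mutualInfo p X Y :=
  ((continuous_entropy _).add (continuous_entropy _)).sub (continuous_entropy _)

lemma continuous_condMutualInfo (X : Ω → A) (Y : Ω → B) (Z : Ω → C) :
    Continuous fun p : Distr Ω => condMutualInfo p X Y Z :=
  (((continuous_entropy _).add (continuous_entropy _)).sub (continuous_entropy _)).sub
    (continuous_entropy _)

lemma continuous_infoVector (c₀ : Ω → C₀) (c₁ : Ω → C₁) (c₂ : Ω → C₂) (a : Ω → A)
    (Y : Ω → B₁ × B₂) : Continuous fun p => infoVector p c₀ c₁ c₂ a Y := by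
  refine continuous_pi fun j => ?_
  fin_cases j <;>
    simp only [infoVector, Fin.reduceFinMk, Matrix.cons_val, Fin.zero_eta, Fin.mk_one,
      Fin.isValue] <;>
    first
    | exact continuous_mutualInfo _ _
    | exact (continuous_mutualInfo _ _).add (continuous_condMutualInfo _ _ _)
    | exact ((continuous_mutualInfo _ _).add (continuous_condMutualInfo _ _ _)).add
        (continuous_condMutualInfo _ _ _)

lemma continuous_joint :
    Continuous fun t : Channel A (C₀ × C₁ × C₂) × Distr A × Channel A (B₁ × B₂) =>
      joint t.1 t.2.1 t.2.2 := by
  refine Continuous.subtype_mk (continuous_pi fun ω => ?_) _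
  refine ((?_ : Continuous _).mul ?_).mul ?_
  · exact (continuous_channel_apply ω.2.1 ω.1).comp continuous_fst
  · exact (continuous_apply ω.2.1).comp (continuous_subtype_val.comp continuous_snd.fst)
  · exact (continuous_channel_apply ω.2.1 ω.2.2).comp continuous_snd.snd

lemma continuous_measurements {Z : Type*} [TopologicalSpace Z]
    {θ : Z → Channel A (C₀ × C₁ × C₂)} {p : Z → Distr A} {K : Z → Channel A (B₁ × B₂)}
    (hθ : Continuous θ) (hp : Continuous p) (hK : Continuous K) :
    Continuous fun z => measurements (θ z) (p z) (K z) :=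
  (continuous_infoVector _ _ _ _ _).comp (continuous_joint.comp (hθ.prodMk (hp.prodMk hK)))

lemma continuous_distortion₁ (p : Distr A) (w : A → B₁ → ℝ≥0) :
    Continuous fun Q : Channel A (B₁ × B₂) => distortion₁ p Q w :=
  continuous_finsetSum _ fun a _ => continuous_finsetSum _ fun b _ =>
    ((continuous_channel_apply a b).const_mul (p a)).mul_const _

lemma continuous_distortion₂ (p : Distr A) (w : A → B₂ → ℝ≥0) :
    Continuous fun Q : Channel A (B₁ × B₂) => distortion₂ p Q w :=
  continuous_finsetSum _ fun a _ => continuous_finsetSum _ fun b _ =>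
    ((continuous_channel_apply a b).const_mul (p a)).mul_const _

variable {S T₁ T₂ X Y₁ Y₂ : Type*} [Fintype S] [Fintype T₁] [Fintype T₂] [Fintype X]
  [Fintype Y₁] [Fintype Y₂] {pS : Distr S} {W : Channel X (Y₁ × Y₂)} {w₁ : S → T₁ → ℝ≥0}
  {w₂ : S → T₂ → ℝ≥0} {κ d₁ d₂ : ℝ}

lemma isClosed_setOf_isDominated (pS : Distr S) (W : Channel X (Y₁ × Y₂)) :
    IsClosed {t : ℝ × Channel S (T₁ × T₂) × Distr X | IsDominated t.1 pS t.2.1 t.2.2 W} := by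
  simp only [IsDominated, Set.ofPred_forall]
  refine isClosed_iInter fun k₀ => isClosed_iInter fun k₁ => isClosed_iInter fun k₂ =>
    isClosed_iInter fun U => ?_
  have hclosed : IsClosed {z : (ℝ × Channel S (T₁ × T₂) × Distr X) × BoundedTest X |
      measurements U pS z.1.2.1 ≤ z.1.1 • measurements z.2 z.1.2.2 W} :=
    isClosed_le
      (continuous_measurements continuous_const continuous_const continuous_fst.snd.fst)
      (continuous_fst.fst.smul
        (continuous_measurements continuous_snd continuous_fst.snd.snd continuous_const))
  convert isClosedMap_fst_of_compactSpace _ hclosed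
  ext t
  simp

/-- The slacks `ε` for which a virtual channel and an input law exist form a projection of a closed
set along a compact space, so they are closed under limits. -/
theorem Achievable.exists_isDominated [Nonempty X] (h : Achievable pS W w₁ w₂ κ d₁ d₂) :
    ∃ (Q : Channel S (T₁ × T₂)) (pX : Distr X), distortion₁ pS Q w₁ ≤ d₁ ∧
      distortion₂ pS Q w₂ ≤ d₂ ∧ IsDominated κ pS Q pX W := by
  let slacks : Set ℝ := {ε | ∃ t : Channel S (T₁ × T₂) × Distr X, distortion₁ pS t.1 w₁ ≤ d₁ + ε ∧
    distortion₂ pS t.1 w₂ ≤ d₂ + ε ∧ IsDominated (κ + ε) pS t.1 t.2 W}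
  have hclosed : IsClosed slacks := by
    have h₁ : IsClosed {z : ℝ × Channel S (T₁ × T₂) × Distr X |
        distortion₁ pS z.2.1 w₁ ≤ d₁ + z.1} :=
      isClosed_le ((continuous_distortion₁ pS w₁).comp continuous_snd.fst)
        (continuous_const.add continuous_fst)
    have h₂ : IsClosed {z : ℝ × Channel S (T₁ × T₂) × Distr X |
        distortion₂ pS z.2.1 w₂ ≤ d₂ + z.1} :=
      isClosed_le ((continuous_distortion₂ pS w₂).comp continuous_snd.fst)
        (continuous_const.add continuous_fst)
    have h₃ : IsClosed {z : ℝ × Channel S (T₁ × T₂) × Distr X |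
        IsDominated (κ + z.1) pS z.2.1 z.2.2 W} :=
      (isClosed_setOf_isDominated pS W).preimage
        ((continuous_const.add continuous_fst).prodMk continuous_snd)
    convert isClosedMap_fst_of_compactSpace _ (h₁.inter (h₂.inter h₃))
    ext ε
    simp [slacks]
  have hpos : Set.Ioi 0 ⊆ slacks := fun ε hε => by
    obtain ⟨Q, pX, hε⟩ := h.exists_isDominated_add hε
    exact ⟨(Q, pX), hε⟩
  obtain ⟨⟨Q, pX⟩, hzero⟩ : (0 : ℝ) ∈ slacks :=
    hclosed.closure_subset_iff.2 hpos (by rw [closure_Ioi]; exact Set.self_mem_Ici)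
  simp only [add_zero] at hzero
  exact ⟨Q, pX, hzero⟩

end Limits

/-! ### Alphabets of bounded size suffice -/

section SmallTests

variable {S T₁ T₂ X Y₁ Y₂ : Type*} [Fintype S] [Fintype T₁] [Fintype T₂] [Fintype X]
  [Fintype Y₁] [Fintype Y₂] {pS : Distr S} {Q : Channel S (T₁ × T₂)} {pX : Distr X}
  {W : Channel X (Y₁ × Y₂)} {κ : ℝ}

/-- An entropy vector of `Q` is a convex combination of entropy vectors of small test channels, and
the entropy vectors of `Q` dominated by `κ` times those of `W` form a convex set. -/
theorem isDominated_of_small_tests (hκ : 0 ≤ κ)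
    (h : ∀ U : Channel S (Fin (Fintype.card S) × Fin (Fintype.card S) × Fin (Fintype.card S)),
      ∃ (l₀ l₁ l₂ : ℕ) (V : Channel X (Fin l₀ × Fin l₁ × Fin l₂)),
        measurements U pS Q ≤ κ • measurements V pX W) :
    IsDominated κ pS Q pX W := by
  intro k₀ k₁ k₂ U
  let dominated : Set (EntropySpace S) := {y | y.1 = pS ∧ ∃ x ∈ entropyCone W, x.1 = pX ∧
    infoBounds Q y ≤ κ • infoBounds W x}
  have hconvex : Convex ℝ dominated := by
    rintro y ⟨hy, x, hx, hxp, hle⟩ y' ⟨hy', x', hx', hxp', hle'⟩ a b ha hb hab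
    refine ⟨by simp [hy, hy', ← add_smul, hab], a • x + b • x',
      Submodule.add_mem _ (smul_mem_span_nnreal ha hx) (smul_mem_span_nnreal hb hx'),
      by simp [hxp, hxp', ← add_smul, hab], ?_⟩
    rw [infoBounds_convexComb Q (hy.trans hy'.symm) hab,
      infoBounds_convexComb W (hxp.trans hxp'.symm) hab, smul_add, smul_comm κ a, smul_comm κ b]
    gcongr
  have hsmall : {y | ∃ θ : Channel S
      (Fin (Fintype.card S) × Fin (Fintype.card S) × Fin (Fintype.card S)),
      channelPoint θ pS Q = y} ⊆ dominated := by
    rintro _ ⟨U', rfl⟩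
    obtain ⟨l₀, l₁, l₂, V, hV⟩ := h U'
    refine ⟨channelPoint_fst U' pS Q, channelPoint V pX W, channelPoint_mem_entropyCone V pX W,
      channelPoint_fst V pX W, ?_⟩
    rwa [← measurements_eq_infoBounds, ← measurements_eq_infoBounds]
  obtain ⟨-, x, hx, hxp, hle⟩ := convexHull_min hsmall hconvex
    (mem_convexHull_channelPoint (channelPoint_mem_entropyCone U pS Q) (channelPoint_fst U pS Q))
  obtain ⟨V, hV⟩ := exists_infoBounds_le_measurements hx hxp
  refine ⟨V, ?_⟩
  rw [measurements_eq_infoBounds U]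
  exact hle.trans (smul_le_smul_of_nonneg_left hV hκ)

end SmallTests

end

end SourceBroadcast

theorem theorem1 {S T₁ T₂ X Y₁ Y₂ : Type*}
    [Fintype S] [Fintype T₁] [Fintype T₂] [Fintype X] [Nonempty X] [Fintype Y₁] [Fintype Y₂]
    (pS : Distr S) (W : Channel X (Y₁ × Y₂)) (w₁ : S → T₁ → ℝ≥0) (w₂ : S → T₂ → ℝ≥0)
    (κ d₁ d₂ : ℝ) (hach : Achievable pS W w₁ w₂ κ d₁ d₂) :
    -- the necessary condition: `U₀, U₁, U₂` range over all finite alphabets,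
    -- and `V₀, V₁, V₂` can be found within the cardinality bounds
    (∃ (Q : Channel S (T₁ × T₂)) (pX : Distr X),
      distortion₁ pS Q w₁ ≤ d₁ ∧ distortion₂ pS Q w₂ ≤ d₂ ∧
      ∀ (k₀ k₁ k₂ : ℕ) (U : Channel S (Fin k₀ × Fin k₁ × Fin k₂)),
        ∃ (l₀ l₁ l₂ : ℕ) (V : Channel X (Fin l₀ × Fin l₁ × Fin l₂)),
          l₀ ≤ Fintype.card X + 5 ∧ l₁ ≤ Fintype.card X ∧ l₂ ≤ Fintype.card X ∧
          ∀ j, measurements U pS Q j ≤ κ * measurements V pX W j) ∧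
    -- it suffices to consider test distributions within the cardinality bounds
    (∀ (Q : Channel S (T₁ × T₂)) (pX : Distr X),
      (∀ (k₀ k₁ k₂ : ℕ) (U : Channel S (Fin k₀ × Fin k₁ × Fin k₂)),
        k₀ ≤ Fintype.card S → k₁ ≤ Fintype.card S → k₂ ≤ Fintype.card S →
        ∃ (l₀ l₁ l₂ : ℕ) (V : Channel X (Fin l₀ × Fin l₁ × Fin l₂)),
          l₀ ≤ Fintype.card X + 5 ∧ l₁ ≤ Fintype.card X ∧ l₂ ≤ Fintype.card X ∧
          ∀ j, measurements U pS Q j ≤ κ * measurements V pX W j) ↔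
      (∀ (k₀ k₁ k₂ : ℕ) (U : Channel S (Fin k₀ × Fin k₁ × Fin k₂)),
        ∃ (l₀ l₁ l₂ : ℕ) (V : Channel X (Fin l₀ × Fin l₁ × Fin l₂)),
          ∀ j, measurements U pS Q j ≤ κ * measurements V pX W j)) := by
  have hκ := hach.nonneg
  refine ⟨?_, fun Q pX => ⟨fun h k₀ k₁ k₂ U => ?_, fun h k₀ k₁ k₂ U _ _ _ => ?_⟩⟩
  · obtain ⟨Q, pX, h₁, h₂, hdom⟩ := hach.exists_isDominated
    refine ⟨Q, pX, h₁, h₂, fun k₀ k₁ k₂ U => ?_⟩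
    obtain ⟨V, hV⟩ := hdom k₀ k₁ k₂ U
    exact ⟨_, _, _, V, le_rfl, le_rfl, le_rfl, hV⟩
  · have hdom : IsDominated κ pS Q pX W := isDominated_of_small_tests hκ fun U => by
      obtain ⟨l₀, l₁, l₂, V, -, -, -, hV⟩ := h _ _ _ U le_rfl le_rfl le_rfl
      exact ⟨l₀, l₁, l₂, V, hV⟩
    obtain ⟨V, hV⟩ := hdom k₀ k₁ k₂ U
    exact ⟨_, _, _, V, hV⟩
  · obtain ⟨V, hV⟩ := isDominated_of_small_tests hκ (fun U => h _ _ _ U) k₀ k₁ k₂ U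
    exact ⟨_, _, _, V, le_rfl, le_rfl, le_rfl, hV⟩
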